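/- Let $\mathbb{K}$ be a commutative ring, and let $S$ be an abstract simplicial complex, that is, a (possibly infinite) collection of non-empty finite sets, called simplices, closed under passing to non-empty subsets. **Quivers.** A quiver $Q$ consists of sets $Q_0$ (vertices) and $Q_1$ (arrows) with maps $t,h:Q_1\to Q_0$ (tail, head) and $s:Q_0\to Q_1$ such that $ts=\mathrm{id}=hs$. The arrows $s(v)$ are called degenerate. Write $Q(v,u)$ for the set of arrows with tail $v$ and head $u$. Let $\mathcal{Z}(Q)$ be the category with object set $Q_0$ and morphisms $\mathcal{Z}(Q)(v,u)=Q(v,u)\sqcup\{z_{v,u}\}$, where $z_{v,u}$ is a new formal arrow. The identities are the degenerate arrows, and the composition of any two composable non-identity morphisms $v\to v'\to v''$ is $z_{v,v''}$. **Square-commutative homology.** Let $N$ be the normalized chain complex of the simplicial $\mathbb{K}$-module $\mathbb{K}[\mathrm{nerve}\,\mathcal{Z}(Q)]$, that is, the complex of chains with $\partial=\sum_i(-1)^id_i$, modulo the chains spanned by degenerate simplices. Let $D_n\subseteq N_n$ be the image of the span of those $n$-simplices of the nerve that are composable sequences of $n$ arrows of $Q$ (for $n=0$: the vertices). Put $$\Omega^{\mathsf{sc}}_n(Q)=D_n\cap\partial^{-1}(D_{n-1})\qquad(D_{-1}=0).$$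 This is the largest subcomplex of $N$ contained in $D$. Set $H^{\mathsf{sc}}_n(Q)=H_n(\Omega^{\mathsf{sc}}(Q))$. **The digraph of $S$.** Let $G(S)$ be the digraph whose vertices are the simplices of $S$ and which has exactly one non-degenerate edge $\sigma\to\tau$ whenever $\tau\subseteq\sigma$ and $\dim\sigma=\dim\tau+1$, and no other non-degenerate edges. Regard it as a quiver by adding one degenerate loop at each vertex. **Theorem.** For every $n\ge 0$ there is an isomorphism of $\mathbb{K}$-modules $$H_n(S)\cong H^{\mathsf{sc}}_n(G(S)),$$ where $H_n(S)$ is the (unreduced, oriented) simplicial homology of $S$ with coefficients in $\mathbb{K}$. -/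

import Mathlib

namespace PathHomology

noncomputable section

open CategoryTheory Opposite

universe w u v

/-! ### Quotients and maximal subcomplexes of chain complexes -/

section Complexes

variable {K : Type w} [CommRing K]

/-- The quotient of a chain complex `C` by a subcomplex `D`. -/
def quotientComplex (C : ChainComplex (ModuleCat.{u} K) ℕ) (D : ∀ n, Submodule K (C.X n))
    (hD : ∀ i j, D i ≤ (D j).comap (C.d i j).hom) : ChainComplex (ModuleCat.{u} K) ℕ where
  X n := ModuleCat.of K (C.X n ⧸ D n)
  d i j := ModuleCat.ofHom (Submodule.mapQ (D i) (D j) (C.d i j).hom (hD i j))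
  shape i j h := by
    ext x
    simp [C.shape i j h]
  d_comp_d' i j k _ _ := by
    ext x
    have h : (C.d j k) ((C.d i j) x) = 0 := by
      rw [← ModuleCat.comp_apply, C.d_comp_d]; rfl
    simp [h]

/-- For a graded submodule `D` of a chain complex `C` (not necessarily a subcomplex), the
degree `n` part `D n ∩ ∂⁻¹(D (n - 1))` of the largest subcomplex of `C` contained in `D`.
For `m ≠ n - 1` the condition is vacuous, as `C.d n m = 0`. -/
def omegaSubmodule (C : ChainComplex (ModuleCat.{u} K) ℕ) (D : ∀ n, Submodule K (C.X n))
    (n : ℕ) : Submodule K (C.X n) :=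
  D n ⊓ ⨅ m, (D m).comap (C.d n m).hom

theorem mem_omegaSubmodule {C : ChainComplex (ModuleCat.{u} K) ℕ}
    {D : ∀ n, Submodule K (C.X n)} {n : ℕ} {x : C.X n} :
    x ∈ omegaSubmodule C D n ↔ x ∈ D n ∧ ∀ m, (C.d n m).hom x ∈ D m := by
  simp [omegaSubmodule, Submodule.mem_iInf]

theorem d_mem_omegaSubmodule (C : ChainComplex (ModuleCat.{u} K) ℕ)
    (D : ∀ n, Submodule K (C.X n)) (i j : ℕ) (x : C.X i) (hx : x ∈ omegaSubmodule C D i) :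
    (C.d i j).hom x ∈ omegaSubmodule C D j := by
  rw [mem_omegaSubmodule] at hx ⊢
  refine ⟨hx.2 j, fun m => ?_⟩
  have h : (C.d j m).hom ((C.d i j).hom x) = 0 := by
    rw [← LinearMap.comp_apply, ← ModuleCat.hom_comp, C.d_comp_d]; rfl
  rw [h]
  exact Submodule.zero_mem _

/-- The complex `ω(C, D)`: the largest subcomplex of `C` whose components lie in the graded
submodule `D`. -/
def omega (C : ChainComplex (ModuleCat.{u} K) ℕ) (D : ∀ n, Submodule K (C.X n)) :
    ChainComplex (ModuleCat.{u} K) ℕ where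
  X n := ModuleCat.of K (omegaSubmodule C D n)
  d i j := ModuleCat.ofHom ((C.d i j).hom.restrict (d_mem_omegaSubmodule C D i j))
  shape i j h := by
    apply ModuleCat.hom_ext
    refine LinearMap.ext fun x => Subtype.ext ?_
    simp [LinearMap.restrict_apply, C.shape i j h]
  d_comp_d' i j k _ _ := by
    apply ModuleCat.hom_ext
    refine LinearMap.ext fun x => Subtype.ext ?_
    have h : (C.d j k) ((C.d i j) x.1) = 0 := by
      rw [← ModuleCat.comp_apply, C.d_comp_d]; rfl
    simpa [LinearMap.restrict_apply] using h

end Complexes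

/-! ### Simplicial modules -/

section SimplicialModules

open Simplicial

/-- The functor sending a set `X` to the free module `K[X] = X →₀ K`. -/
def freeModule (K : Type w) [CommRing K] : Type u ⥤ ModuleCat.{max u w} K where
  obj X := ModuleCat.of K (X →₀ K)
  map f := ModuleCat.ofHom (Finsupp.lmapDomain K K (f : _ → _))
  map_id X := by
    apply ModuleCat.hom_ext
    exact Finsupp.lmapDomain_id K K
  map_comp f g := by
    apply ModuleCat.hom_ext
    exact Finsupp.lmapDomain_comp K K (f : _ → _) (g : _ → _)

/-- The simplicial module `K[X]` of a simplicial set `X`. -/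
def freeSimplicialModule (K : Type w) [CommRing K] (X : SSet.{u}) :
    SimplicialObject (ModuleCat.{max u w} K) :=
  ((SimplicialObject.whiskering _ _).obj (freeModule K)).obj X

/-- The basis element of `K[X]_n` given by an `n`-simplex. -/
def basisElement (K : Type w) [CommRing K] {X : SSet.{u}} {n : ℕ} (x : X _⦋n⦌) :
    (freeSimplicialModule K X) _⦋n⦌ :=
  (Finsupp.single x 1 : X _⦋n⦌ →₀ K)

theorem δ_basisElement (K : Type w) [CommRing K] {X : SSet.{u}} {n : ℕ} (i : Fin (n + 2))
    (x : X _⦋n + 1⦌) :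
    ((freeSimplicialModule K X).δ i).hom (basisElement K x) = basisElement K (X.δ i x) :=
  Finsupp.mapDomain_single

variable {K : Type w} [CommRing K]

/-- The submodule of `A_n` spanned by the images of the degeneracy maps. -/
def degenerateSubmodule (A : SimplicialObject (ModuleCat.{u} K)) (n : ℕ) :
    Submodule K (A _⦋n⦌) :=
  match n with
  | 0 => ⊥
  | n + 1 => ⨆ i : Fin (n + 1), LinearMap.range (A.σ i).hom

/-- The (unnormalized) chain complex of a simplicial module, with `∂ = ∑ (-1)^i d_i`. -/
abbrev chains (A : SimplicialObject (ModuleCat.{u} K)) : ChainComplex (ModuleCat.{u} K) ℕ :=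
  AlgebraicTopology.AlternatingFaceMapComplex.obj A

theorem chains_d_apply (A : SimplicialObject (ModuleCat.{u} K)) (n : ℕ) (x : A _⦋n + 1⦌) :
    ((chains A).d (n + 1) n).hom x =
      ∑ i : Fin (n + 2), (-1 : ℤ) ^ (i : ℕ) • (A.δ i).hom x := by
  simp [ModuleCat.hom_sum, LinearMap.sum_apply]

theorem σ_mem_degenerateSubmodule (A : SimplicialObject (ModuleCat.{u} K)) (n : ℕ)
    (j : Fin (n + 1)) (a : A _⦋n⦌) :
    (A.σ j).hom a ∈ degenerateSubmodule A (n + 1) :=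
  Submodule.mem_iSup_of_mem (p := fun i : Fin (n + 1) => LinearMap.range (A.σ i).hom) j ⟨a, rfl⟩

theorem δ_σ_mem_degenerateSubmodule (A : SimplicialObject (ModuleCat.{u} K)) (n : ℕ)
    (i : Fin (n + 2)) (j : Fin (n + 1)) (hi : i ≠ j.castSucc) (hi' : i ≠ j.succ) (a : A _⦋n⦌) :
    (A.δ i).hom ((A.σ j).hom a) ∈ degenerateSubmodule A n := by
  have key : (A.δ i).hom ((A.σ j).hom a) = (A.σ j ≫ A.δ i).hom a := rfl
  rw [key]
  cases n with
  | zero =>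
    exfalso
    fin_cases j
    fin_cases i
    · exact hi rfl
    · exact hi' rfl
  | succ m =>
    rcases lt_or_gt_of_ne hi with h | h
    · -- the face index lies below the degeneracy index
      have hj : j ≠ 0 := by
        rintro rfl
        simp at h
      obtain ⟨k, rfl⟩ := Fin.exists_succ_eq.2 hj
      have hne : i ≠ Fin.last (m + 2) := by
        rintro rfl
        exact absurd h (by simp [Fin.lt_def]; omega)
      obtain ⟨l, rfl⟩ := Fin.exists_castSucc_eq.2 hne
      have hle : l ≤ Fin.castSucc k := by
        simp only [Fin.lt_def, Fin.le_def, Fin.val_castSucc, Fin.val_succ] at h ⊢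
        omega
      rw [A.δ_comp_σ_of_le hle]
      exact σ_mem_degenerateSubmodule A m k _
    · -- the face index lies above the degeneracy index
      have hlt : j.succ < i := by
        have : (i : ℕ) ≠ j + 1 := fun e => hi' (Fin.ext (by simpa using e))
        simp only [gt_iff_lt, Fin.lt_def, Fin.val_castSucc, Fin.val_succ] at h ⊢
        omega
      rw [A.δ_comp_σ_of_gt' hlt]
      exact σ_mem_degenerateSubmodule A m _ _

theorem degenerateSubmodule_le_comap (A : SimplicialObject (ModuleCat.{u} K)) (i j : ℕ) :
    degenerateSubmodule A i ≤ (degenerateSubmodule A j).comap ((chains A).d i j).hom := by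
  by_cases h : j + 1 = i
  · subst h
    refine iSup_le fun k => ?_
    rintro _ ⟨a, rfl⟩
    rw [Submodule.mem_comap, chains_d_apply,
      ← Finset.add_sum_erase Finset.univ _ (Finset.mem_univ k.castSucc),
      ← Finset.add_sum_erase (Finset.univ.erase k.castSucc) _
        (Finset.mem_erase.2 ⟨(Fin.castSucc_lt_succ (i := k)).ne', Finset.mem_univ k.succ⟩),
      ← add_assoc]
    refine Submodule.add_mem _ ?_ (Submodule.sum_mem _ fun l hl => ?_)
    · have h₁ : (A.δ k.castSucc).hom ((A.σ k).hom a) = a :=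
        congrArg (fun f => ModuleCat.Hom.hom f a) (A.δ_comp_σ_self (i := k))
      have h₂ : (A.δ k.succ).hom ((A.σ k).hom a) = a :=
        congrArg (fun f => ModuleCat.Hom.hom f a) (A.δ_comp_σ_succ (i := k))
      rw [h₁, h₂]
      simp [pow_succ]
    · simp only [Finset.mem_erase, Finset.mem_univ, and_true] at hl
      exact zsmul_mem (δ_σ_mem_degenerateSubmodule A j l k hl.2 hl.1 a) _
  · have h' : (chains A).d i j = 0 := (chains A).shape i j h
    rw [h']
    intro x _
    exact Submodule.zero_mem _

/-- The normalized chain complex of a simplicial module: the chains modulo degenerate chains. -/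
def normalizedChains (A : SimplicialObject (ModuleCat.{u} K)) :
    ChainComplex (ModuleCat.{u} K) ℕ :=
  quotientComplex (chains A) (degenerateSubmodule A) (degenerateSubmodule_le_comap A)

/-- The complex `Ω(A, B)` of a simplicial module `A` and a graded submodule `B`: the largest
subcomplex of the normalized chain complex of `A` contained in the image of `B`. -/
def Omega (A : SimplicialObject (ModuleCat.{u} K)) (B : ∀ n : ℕ, Submodule K (A _⦋n⦌)) :
    ChainComplex (ModuleCat.{u} K) ℕ :=
  omega (normalizedChains A) (fun n => (B n).map (degenerateSubmodule A n).mkQ)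

end SimplicialModules

/-! ### Embedded quivers -/

section EmbeddedQuivers

/-- A subquiver of a category: a set of objects and a set of morphisms between them which
contains the identities of these objects. -/
structure Subquiver (C : Type u) [Category.{v} C] where
  /-- the vertices -/
  verts : Set C
  /-- the arrows -/
  arrows : ∀ a b : C, Set (a ⟶ b)
  source_mem : ∀ {a b : C} {f : a ⟶ b}, f ∈ arrows a b → a ∈ verts
  target_mem : ∀ {a b : C} {f : a ⟶ b}, f ∈ arrows a b → b ∈ verts
  id_mem : ∀ {a : C}, a ∈ verts → 𝟙 a ∈ arrows a a

variable {C : Type u} [Category.{v} C]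

/-- The set of `n`-paths of a subquiver `Q` of a category, as a subset of the `n`-simplices
of the nerve: the composable sequences of `n` morphisms all of which are arrows of `Q`. -/
def Subquiver.nerve (Q : Subquiver C) (n : ℕ) : Set ((CategoryTheory.nerve C).obj (op (SimplexCategory.mk n))) :=
  {F : ComposableArrows C n | (∀ i : Fin (n + 1), F.obj i ∈ Q.verts) ∧
    ∀ (i : ℕ) (hi : i < n), F.map' i (i + 1) ∈ Q.arrows _ _}

/-- The complex `Ω(C, Q)` of an embedded quiver, with coefficients in `K`: it is the complex
`Ω(K[nerve C], K[nerve Q])`. -/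
def OmegaEmbedded (K : Type w) [CommRing K] (Q : Subquiver C) :
    ChainComplex (ModuleCat.{max u v w} K) ℕ :=
  Omega (freeSimplicialModule K (CategoryTheory.nerve C))
    (fun n => Finsupp.supported K K (Q.nerve n))

end EmbeddedQuivers

/-! ### Square-commutative homology of quivers

A quiver here has a distinguished (degenerate) loop at each vertex: it is a `ReflQuiver`. -/

section SquareCommutative

/-- The objects of the category `Z(Q)`: the vertices of `Q`. -/
structure ZCat (V : Type u) where
  /-- the underlying vertex -/
  vertex : V

variable {V : Type u} [ReflQuiver.{v} V]

/-- The morphisms of `Z(Q)`: the arrows of `Q`, and one new formal arrow `z` for each ordered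
pair of vertices. -/
inductive ZHom (a b : V) : Type v where
  | arrow (f : a ⟶ b) : ZHom a b
  | z : ZHom a b

namespace ZHom

/-- The identity of a vertex in `Z(Q)`: its degenerate arrow. -/
def id (a : V) : ZHom a a := arrow (ReflQuiver.id a)

/-- A morphism of `Z(Q)` is an identity if it is a degenerate arrow of `Q`. -/
def IsId {a b : V} (f : ZHom a b) : Prop := ∃ h : a = b, h ▸ ZHom.id a = f

open Classical in
/-- The composition, `f` followed by `g`, of two morphisms of `Z(Q)`: degenerate arrows act as
identities, and every other composition is `z`. -/
def comp {a b c : V} (f : ZHom a b) (g : ZHom b c) : ZHom a c :=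
  if h : f.IsId then h.fst ▸ g
  else if h : g.IsId then h.fst ▸ f
  else z

theorem isId_id (a : V) : (ZHom.id a).IsId := ⟨rfl, rfl⟩

theorem not_isId_z {a b : V} : ¬ (z : ZHom a b).IsId := by
  rintro ⟨h, h'⟩
  subst h
  cases h'

theorem id_comp {a b : V} (f : ZHom a b) : (ZHom.id a).comp f = f := by
  unfold comp
  rw [dif_pos (isId_id a)]

theorem comp_id {a b : V} (f : ZHom a b) : f.comp (ZHom.id b) = f := by
  unfold comp
  by_cases h : f.IsId
  · rw [dif_pos h]
    obtain ⟨h, rfl⟩ := h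
    subst h
    rfl
  · rw [dif_neg h, dif_pos (isId_id b)]

theorem comp_of_not_isId {a b c : V} {f : ZHom a b} {g : ZHom b c} (hf : ¬ f.IsId)
    (hg : ¬ g.IsId) : f.comp g = z := by
  unfold comp
  rw [dif_neg hf, dif_neg hg]

theorem comp_assoc {a b c d : V} (f : ZHom a b) (g : ZHom b c) (k : ZHom c d) :
    (f.comp g).comp k = f.comp (g.comp k) := by
  by_cases hf : f.IsId
  · obtain ⟨rfl, rfl⟩ := hf
    simp only [id_comp]
  by_cases hg : g.IsId
  · obtain ⟨rfl, rfl⟩ := hg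
    simp only [id_comp, comp_id]
  by_cases hk : k.IsId
  · obtain ⟨rfl, rfl⟩ := hk
    simp only [comp_id]
  rw [comp_of_not_isId hf hg, comp_of_not_isId hg hk, comp_of_not_isId not_isId_z hk,
    comp_of_not_isId hf not_isId_z]

end ZHom

/-- The category `Z(Q)`. -/
instance : Category.{v} (ZCat V) where
  Hom a b := ZHom a.vertex b.vertex
  id a := ZHom.id a.vertex
  comp f g := ZHom.comp f g
  id_comp f := ZHom.id_comp f
  comp_id f := ZHom.comp_id f
  assoc f g k := ZHom.comp_assoc f g k

variable (V) in
/-- The quiver `Q` as a subquiver of `Z(Q)`. -/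
def quiverInZ : Subquiver (ZCat V) where
  verts := Set.univ
  arrows a b := Set.range (fun f : a.vertex ⟶ b.vertex => (ZHom.arrow f : ZHom _ _))
  source_mem _ := Set.mem_univ _
  target_mem _ := Set.mem_univ _
  id_mem {a} _ := ⟨ReflQuiver.id a.vertex, rfl⟩

/-- The complex `Ω^sc(Q) = Ω(Z(Q), Q)` of a quiver `Q`. -/
def OmegaSC (K : Type w) [CommRing K] (V : Type u) [ReflQuiver.{v} V] :
    ChainComplex (ModuleCat.{max u v w} K) ℕ :=
  OmegaEmbedded K (quiverInZ V)

/-- The square-commutative homology `H^sc_n(Q)` of a quiver `Q` with coefficients in `K`. -/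
def homologySC (K : Type w) [CommRing K] (V : Type u) [ReflQuiver.{v} V] (n : ℕ) :
    ModuleCat.{max u v w} K :=
  (OmegaSC K V).homology n

end SquareCommutative

/-! ### Digraphs and the digraph of a simplicial complex -/

section Digraphs

/-- A digraph in the present sense: a set `V` with a reflexive relation. The pairs `(v, v)` are
the degenerate edges. -/
structure ReflDigraph (V : Type u) where
  /-- the edge relation -/
  Adj : V → V → Prop
  refl : ∀ v, Adj v v

/-- The vertices of a digraph, as a type on which the digraph is a quiver. -/
def ReflDigraph.Vertex {V : Type u} (_G : ReflDigraph V) : Type u := V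

/-- The quiver of a digraph: exactly one arrow for each edge. -/
instance {V : Type u} (G : ReflDigraph V) : ReflQuiver.{0} G.Vertex where
  Hom a b := PLift (G.Adj a b)
  id a := ⟨G.refl a⟩

/-- The digraph `G(S)` of a simplicial complex: its vertices are the simplices of `S`, and
besides the degenerate edges there is an edge `σ → τ` whenever `τ` is a face of `σ` of
codimension one. -/
def faceDigraph {ι : Type u} (S : PreAbstractSimplicialComplex ι) :
    ReflDigraph {σ : (Finset ι) // σ ∈ S.faces} where
  Adj σ τ := σ = τ ∨ (τ.1 ⊆ σ.1 ∧ σ.1.card = τ.1.card + 1)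
  refl _ := Or.inl rfl

end Digraphs

/-! ### Simplicial homology of a simplicial complex -/

section SimplicialHomology

open Simplicial

variable {ι : Type u} (S : PreAbstractSimplicialComplex ι)

/-- The simplicial set of ordered simplices of `S`: an `n`-simplex is a tuple
`(v₀, …, vₙ)` of vertices, possibly with repetitions, lying in a common simplex of `S`. -/
def orderedSimplices : SSet.{u} where
  obj n := {f : (Fin (n.unop.len + 1) → ι) // ∃ σ ∈ S.faces, ∀ i, f i ∈ σ}
  map g := ↾(fun f => ⟨f.1 ∘ g.unop.toOrderHom,
    f.2.imp fun _ h => ⟨h.1, fun i => h.2 (g.unop.toOrderHom i)⟩⟩)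
  map_id _ := rfl
  map_comp _ _ := rfl

variable {S}

/-- The vertices `v₀, …, vₙ` of an ordered simplex. -/
def vertices {n : ℕ} (f : orderedSimplices S _⦋n⦌) : Fin (n + 1) → ι := f.1

theorem vertices_δ {n : ℕ} (f : orderedSimplices S _⦋n + 1⦌) (i : Fin (n + 2))
    (j : Fin (n + 1)) :
    vertices ((orderedSimplices S).δ i f) j = vertices f (i.succAbove j) := rfl

theorem ext_vertices {n : ℕ} {f g : orderedSimplices S _⦋n⦌} (h : vertices f = vertices g) :
    f = g := Subtype.ext h

/-- The ordered simplex `(v_{π 0}, …, v_{π n})` obtained by permuting vertices. -/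
def permute {n : ℕ} (f : orderedSimplices S _⦋n⦌) (π : Equiv.Perm (Fin (n + 1))) :
    orderedSimplices S _⦋n⦌ :=
  ⟨vertices f ∘ π, f.2.imp fun _ h => ⟨h.1, fun i => h.2 (π i)⟩⟩

theorem vertices_permute {n : ℕ} (f : orderedSimplices S _⦋n⦌) (π : Equiv.Perm (Fin (n + 1)))
    (j : Fin (n + 1)) : vertices (permute f π) j = vertices f (π j) := rfl

theorem exists_permute_δ {n : ℕ} (f : orderedSimplices S _⦋n + 1⦌)
    (π : Equiv.Perm (Fin (n + 2))) (i : Fin (n + 2)) :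
    ∃ ρ : Equiv.Perm (Fin (n + 1)),
      (orderedSimplices S).δ i (permute f π) = permute ((orderedSimplices S).δ (π i) f) ρ ∧
      ((-1 : ℤ) ^ (i : ℕ)) * (Equiv.Perm.sign ρ : ℤ) =
        (Equiv.Perm.sign π : ℤ) * (-1 : ℤ) ^ (π i : ℕ) := by
  -- conjugate `π` by the cycles moving `i` and `π i` to `0`
  obtain ⟨⟨p, ρ⟩, h⟩ := Equiv.Perm.decomposeFin.symm.surjective
    ((π i).cycleRange * π * i.cycleRange⁻¹)
  have hp : p = 0 := by
    have h0 := congrArg (fun e : Equiv.Perm (Fin (n + 2)) => e 0) h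
    simp only [Equiv.Perm.decomposeFin_symm_apply_zero] at h0
    rw [h0]
    simp [Equiv.Perm.mul_apply, Equiv.Perm.inv_def]
  subst hp
  refine ⟨ρ, ?_, ?_⟩
  · apply ext_vertices
    funext j
    have hj := congrArg (fun e : Equiv.Perm (Fin (n + 2)) => (π i).cycleRange.symm (e j.succ)) h
    simp [Equiv.Perm.mul_apply, Equiv.Perm.inv_def] at hj
    exact congrArg (vertices f) hj.symm
  · have hs := congrArg (fun e => ((Equiv.Perm.sign e : ℤˣ) : ℤ)) h
    simp [Equiv.Perm.decomposeFin.symm_sign] at hs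
    rw [hs]
    have hi : ((-1 : ℤ) ^ (i : ℕ)) * ((-1 : ℤ) ^ (i : ℕ)) = 1 := by
      rw [← mul_pow]; simp
    linear_combination ((-1 : ℤ) ^ (π i : ℕ) * (Equiv.Perm.sign π : ℤ)) * hi

variable (K : Type w) [CommRing K]

variable (S) in
/-- The submodule of the ordered chains spanned by the tuples with a repeated vertex and by the
elements `(v_{π 0}, …, v_{π n}) - sgn(π) (v₀, …, vₙ)`. -/
def orientationRelations (n : ℕ) :
    Submodule K ((freeSimplicialModule K (orderedSimplices S)) _⦋n⦌) :=
  Submodule.span K (Set.range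
      (fun f : {f : (orderedSimplices S _⦋n⦌) // ¬ Function.Injective (vertices f)} =>
        basisElement K f.1)) ⊔
    Submodule.span K (Set.range
      (fun p : orderedSimplices S _⦋n⦌ × Equiv.Perm (Fin (n + 1)) =>
        basisElement K (permute p.1 p.2) - (Equiv.Perm.sign p.2 : ℤ) • basisElement K p.1))

theorem basisElement_mem_orientationRelations {n : ℕ} (f : orderedSimplices S _⦋n⦌)
    (hf : ¬ Function.Injective (vertices f)) :
    basisElement K f ∈ orientationRelations S K n :=
  Submodule.mem_sup_left (Submodule.subset_span ⟨⟨f, hf⟩, rfl⟩)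

theorem permute_sub_mem_orientationRelations {n : ℕ} (f : orderedSimplices S _⦋n⦌)
    (π : Equiv.Perm (Fin (n + 1))) :
    basisElement K (permute f π) - (Equiv.Perm.sign π : ℤ) • basisElement K f ∈
      orientationRelations S K n :=
  Submodule.mem_sup_right (Submodule.subset_span ⟨⟨f, π⟩, rfl⟩)

theorem sum_δ_mem_of_not_injective {n : ℕ} (f : orderedSimplices S _⦋n + 1⦌)
    (hf : ¬ Function.Injective (vertices f)) :
    ∑ i : Fin (n + 2), (-1 : ℤ) ^ (i : ℕ) • basisElement K ((orderedSimplices S).δ i f) ∈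
      orientationRelations S K n := by
  obtain ⟨a, b, hab, hne⟩ : ∃ a b, vertices f a = vertices f b ∧ a ≠ b := by
    simpa [Function.Injective] using hf
  rw [← Finset.add_sum_erase Finset.univ _ (Finset.mem_univ a),
    ← Finset.add_sum_erase (Finset.univ.erase a) _
      (Finset.mem_erase.2 ⟨hne.symm, Finset.mem_univ b⟩), ← add_assoc]
  refine Submodule.add_mem _ ?_ (Submodule.sum_mem _ fun l hl => ?_)
  · obtain ⟨ρ, h₁, h₂⟩ := exists_permute_δ f (Equiv.swap a b) a
    have hsw : permute f (Equiv.swap a b) = f := by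
      apply ext_vertices
      funext j
      rw [vertices_permute]
      by_cases ha : j = a
      · rw [ha, Equiv.swap_apply_left, hab]
      by_cases hb : j = b
      · rw [hb, Equiv.swap_apply_right, hab]
      rw [Equiv.swap_apply_of_ne_of_ne ha hb]
    rw [hsw, Equiv.swap_apply_left] at h₁
    rw [Equiv.swap_apply_left, Equiv.Perm.sign_swap hne] at h₂
    have h₃ := permute_sub_mem_orientationRelations K ((orderedSimplices S).δ b f) ρ
    rw [← h₁] at h₃
    have h₄ := zsmul_mem h₃ ((-1 : ℤ) ^ (a : ℕ))
    rw [smul_sub, smul_smul, h₂] at h₄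
    simpa using h₄
  · simp only [Finset.mem_erase, Finset.mem_univ, and_true] at hl
    refine zsmul_mem (basisElement_mem_orientationRelations K _ fun hinj => ?_) _
    obtain ⟨a', rfl⟩ := Fin.exists_succAbove_eq hl.2.symm
    obtain ⟨b', rfl⟩ := Fin.exists_succAbove_eq hl.1.symm
    exact hne (congrArg _ (hinj (by simpa only [vertices_δ] using hab)))

theorem sum_δ_permute_mem {n : ℕ} (f : orderedSimplices S _⦋n + 1⦌)
    (π : Equiv.Perm (Fin (n + 2))) :
    ∑ i : Fin (n + 2), (-1 : ℤ) ^ (i : ℕ) •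
        basisElement K ((orderedSimplices S).δ i (permute f π)) -
      (Equiv.Perm.sign π : ℤ) • ∑ i : Fin (n + 2), (-1 : ℤ) ^ (i : ℕ) •
        basisElement K ((orderedSimplices S).δ i f) ∈ orientationRelations S K n := by
  rw [← Equiv.sum_comp π (fun i : Fin (n + 2) => (-1 : ℤ) ^ (i : ℕ) •
    basisElement K ((orderedSimplices S).δ i f)), Finset.smul_sum, ← Finset.sum_sub_distrib]
  refine Submodule.sum_mem _ fun i _ => ?_
  obtain ⟨ρ, h₁, h₂⟩ := exists_permute_δ f π i
  have h := zsmul_mem (permute_sub_mem_orientationRelations K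
    ((orderedSimplices S).δ (π i) f) ρ) ((-1 : ℤ) ^ (i : ℕ))
  rw [smul_sub, smul_smul, h₂, ← h₁] at h
  rw [smul_smul]
  exact h

theorem orientationRelations_le_comap (i j : ℕ) :
    orientationRelations S K i ≤ (orientationRelations S K j).comap
      ((chains (freeSimplicialModule K (orderedSimplices S))).d i j).hom := by
  by_cases h : j + 1 = i
  · subst h
    refine sup_le (Submodule.span_le.2 ?_) (Submodule.span_le.2 ?_)
    · rintro _ ⟨⟨f, hf⟩, rfl⟩
      have h := sum_δ_mem_of_not_injective K f hf
      simp only [← δ_basisElement, ← chains_d_apply] at h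
      exact h
    · rintro _ ⟨⟨f, π⟩, rfl⟩
      have h := sum_δ_permute_mem K f π
      simp only [← δ_basisElement] at h
      rw [← chains_d_apply, ← chains_d_apply, ← map_zsmul, ← map_sub] at h
      exact h
  · have h' : (chains (freeSimplicialModule K (orderedSimplices S))).d i j = 0 :=
      (chains (freeSimplicialModule K (orderedSimplices S))).shape i j h
    intro x _
    rw [Submodule.mem_comap, h']
    exact Submodule.zero_mem _

variable (S)

/-- The oriented simplicial chain complex of `S` with coefficients in `K`: in degree `n` it is
generated by the ordered simplices `(v₀, …, vₙ)`, modulo those with a repeated vertex and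
modulo `(v_{π 0}, …, v_{π n}) = sgn(π) (v₀, …, vₙ)`, with `∂ = ∑ (-1)^i d_i`. -/
def orientedChains : ChainComplex (ModuleCat.{max u w} K) ℕ :=
  quotientComplex (chains (freeSimplicialModule K (orderedSimplices S)))
    (orientationRelations S K) (orientationRelations_le_comap K)

/-- The simplicial homology `H_n(S)` of `S` with coefficients in `K`. -/
def simplicialHomology (n : ℕ) : ModuleCat.{max u w} K :=
  (orientedChains S K).homology n

end SimplicialHomology

end

end PathHomology

namespace PathHomology

noncomputable section

open CategoryTheory Opposite Simplicial

universe w u v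

/-! ### Words in the faces of a simplicial complex -/

section Words

variable {ι : Type u} {K : Type w} [CommRing K] {n m : ℕ}

/-! The digraph of `S` is the 1-skeleton of the cubical subdivision of `S`, whose `n`-cubes are the
pairs τ ⊆ σ of simplices that differ by `n` elements. The complex Ω^sc turns out to be the cellular
chain complex of this subdivision, and the isomorphism is induced by the subdivision map: an
oriented `n`-simplex goes to the signed sum of the `n`-cubes between the simplex and its vertices.

Cubes. A non-degenerate path removes elements from a simplex σ one at a time, so it is a word of `n`
distinct letters of σ with `n < |σ|`. Composing two consecutive arrows gives a formal arrow, so an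
inner face forgets exactly the order of two adjacent letters. Hence the formal terms of a boundary
cancel if and only if the coefficients change sign under adjacent transpositions
(`mem_cubeChains_of_d_mem`, `δ_pathChain_inner`), and Ω^sc in degree `n` consists of the alternating
chains of such words. Only the outer faces contribute to their boundary: the first face removes the
first letter from σ, the last face drops the last letter and keeps σ (`d_pathChain`).

Simplices. Antisymmetrization identifies oriented `n`-chains with alternating chains on words of `n
+ 1` letters that exhaust their simplex. Deleting the last letter embeds these in Ω^sc, compatibly
with the boundaries (`wordBoundary_orientedToWord`).

Comparison. By `isIso_homologyMap_of_injective` it is enough to write each relative cycle as a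
boundary plus an element of the image. On the words whose set has the largest size, only the last
face acts. For fixed σ this is, up to sign, a contraction on the exterior algebra of K^σ, which is
exact because σ is non-empty (`exists_mapDomain_lastFace_eq`). As long as that size exceeds `n + 1`,
the top layer is therefore the last face of a chain of cubes and can be removed modulo a boundary.
At size `n + 1` the preimage uses up all letters: it is no longer a cube chain, but precisely an
oriented chain (`exists_eq_wordBoundary_add_of_card_le`). -/

theorem exists_of_mapDomain_ne_zero {α β : Type*} {f : α → β} {c : α →₀ K} {b : β}
    (h : Finsupp.mapDomain f c b ≠ 0) : ∃ a, f a = b ∧ c a ≠ 0 := by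
  classical
  have := Finsupp.mapDomain_support (Finsupp.mem_support_iff.2 h)
  obtain ⟨a, ha, hab⟩ := Finset.mem_image.1 this
  exact ⟨a, hab, Finsupp.mem_support_iff.1 ha⟩

/-- A linear combination whose terms cancel in pairs vanishes. -/
theorem linearCombination_eq_zero_of_involution {α M : Type*} [AddCommGroup M] [Module K M]
    (c : α →₀ K) (g : α → M) (τ : α → α) (hτ : ∀ a, τ (τ a) = a) (hc : ∀ a, c (τ a) = -c a)
    (hfix : ∀ a, c a ≠ 0 → τ a ≠ a) (hg : ∀ a, c a ≠ 0 → g (τ a) = g a) :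
    Finsupp.linearCombination K g c = 0 := by
  rw [Finsupp.linearCombination_apply, Finsupp.sum]
  -- `τ` moves every point of the support, so no term is paired with itself and 2 need not be
  -- invertible.
  refine Finset.sum_involution (fun a _ => τ a) (fun a ha => ?_) (fun a ha _ => ?_)
    (fun a ha => ?_) (fun a ha => hτ a)
  · rw [hg a (Finsupp.mem_support_iff.1 ha), hc, neg_smul, add_neg_cancel]
  · exact hfix a (Finsupp.mem_support_iff.1 ha)
  · rw [Finsupp.mem_support_iff, hc, neg_ne_zero]
    exact Finsupp.mem_support_iff.1 ha

theorem mapDomain_eq_zero_of_involution {α β : Type*}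
    (c : α →₀ K) (g : α → β) (τ : α → α) (hτ : ∀ a, τ (τ a) = a) (hc : ∀ a, c (τ a) = -c a)
    (hfix : ∀ a, c a ≠ 0 → τ a ≠ a) (hg : ∀ a, c a ≠ 0 → g (τ a) = g a) :
    Finsupp.mapDomain g c = 0 := by
  have h := linearCombination_eq_zero_of_involution c (fun a => Finsupp.single (g a) (1 : K)) τ hτ
    hc hfix fun a ha => by rw [hg a ha]
  rw [Finsupp.linearCombination_apply] at h
  simpa [Finsupp.mapDomain, Finsupp.smul_single] using h

/-- A pair consisting of a finite set and a sequence of `n` elements, to be removed from that set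
one after the other. -/
abbrev Word (ι : Type u) (n : ℕ) : Type u := Finset ι × (Fin n → ι)

/-- A word is admissible if its set is a simplex, and its letters are distinct elements of it. -/
structure IsWord (S : PreAbstractSimplicialComplex ι) (w : Word ι n) : Prop where
  face : w.1 ∈ S.faces
  inj : Function.Injective w.2
  mem : ∀ i, w.2 i ∈ w.1

/-- Permute the letters of a word. -/
def permWord (π : Equiv.Perm (Fin n)) (w : Word ι n) : Word ι n := (w.1, w.2 ∘ π)

theorem permWord_mul (π ρ : Equiv.Perm (Fin n)) (w : Word ι n) :
    permWord (π * ρ) w = permWord ρ (permWord π w) := rfl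

@[simp] theorem permWord_one (w : Word ι n) : permWord 1 w = w := rfl

theorem IsWord.perm {S : PreAbstractSimplicialComplex ι} {w : Word ι n} (h : IsWord S w)
    (π : Equiv.Perm (Fin n)) : IsWord S (permWord π w) :=
  ⟨h.face, h.inj.comp π.injective, fun i => h.mem (π i)⟩

theorem permWord_injective (π : Equiv.Perm (Fin n)) :
    Function.Injective (permWord π : Word ι n → Word ι n) := by
  intro w w' h
  have := congrArg (permWord π⁻¹) h
  simpa [← permWord_mul] using this

theorem permWord_swap_swap (i j : Fin n) (w : Word ι n) :
    permWord (Equiv.swap i j) (permWord (Equiv.swap i j) w) = w := by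
  rw [← permWord_mul, Equiv.swap_mul_self, permWord_one]

theorem permWord_swap_ne {w : Word ι n} (hw : Function.Injective w.2) {i j : Fin n}
    (hij : i ≠ j) : permWord (Equiv.swap i j) w ≠ w := by
  intro h
  have := congrFun (congrArg Prod.snd h) i
  simp only [permWord, Function.comp_apply, Equiv.swap_apply_left] at this
  exact hij (hw this).symm

/-- The alternating linear combinations of admissible words. -/
def altChains (S : PreAbstractSimplicialComplex ι) (K : Type w) [CommRing K] (n : ℕ) :
    Submodule K (Word ι n →₀ K) where
  -- Repeated letters are excluded by the support condition, not by the sign rule, which would not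
  -- suffice where 2 is a zero divisor.
  carrier := {c | (∀ w, c w ≠ 0 → IsWord S w) ∧
    ∀ w π, c (permWord π w) = ((Equiv.Perm.sign π : ℤˣ) : ℤ) • c w}
  zero_mem' := by simp
  add_mem' := by
    rintro a b ⟨ha, ha'⟩ ⟨hb, hb'⟩
    refine ⟨fun w hw => ?_, fun w π => by simp [ha', hb']⟩
    by_cases h : a w = 0
    · exact hb w fun h' => hw (by simp [h, h'])
    · exact ha w h
  smul_mem' := by
    rintro r a ⟨ha, ha'⟩
    refine ⟨fun w hw => ha w fun h => hw (by simp [h]), fun w π => ?_⟩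
    simp only [Finsupp.smul_apply, ha']
    rw [smul_comm]

variable {S : PreAbstractSimplicialComplex ι}

theorem altChains_swap {c : Word ι n →₀ K} (hc : c ∈ altChains S K n) {i j : Fin n} (hij : i ≠ j)
    (w : Word ι n) : c (permWord (Equiv.swap i j) w) = -c w := by
  rw [hc.2, Equiv.Perm.sign_swap hij]
  simp

/-! ### The action of the symmetric group on alternating chains -/

theorem mapDomain_permWord_apply (c : Word ι n →₀ K) (π : Equiv.Perm (Fin n)) (w : Word ι n) :
    Finsupp.mapDomain (permWord π) c w = c (permWord π⁻¹ w) := by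
  have h : w = permWord π (permWord π⁻¹ w) := by rw [← permWord_mul]; simp
  conv_lhs => rw [h]
  rw [Finsupp.mapDomain_apply (permWord_injective π)]

theorem mapDomain_permWord {c : Word ι n →₀ K} (hc : c ∈ altChains S K n)
    (π : Equiv.Perm (Fin n)) :
    Finsupp.mapDomain (permWord π) c = ((Equiv.Perm.sign π : ℤˣ) : ℤ) • c := by
  ext w
  rw [mapDomain_permWord_apply, hc.2, Equiv.Perm.sign_inv]
  rfl

theorem mem_altChains_of_mapDomain {c : Word ι n →₀ K} (hw : ∀ w, c w ≠ 0 → IsWord S w)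
    (h : ∀ π : Equiv.Perm (Fin n),
      Finsupp.mapDomain (permWord π) c = ((Equiv.Perm.sign π : ℤˣ) : ℤ) • c) :
    c ∈ altChains S K n := by
  refine ⟨hw, fun w π => ?_⟩
  have := congrArg (fun c => c w) (h π⁻¹)
  simpa [mapDomain_permWord_apply] using this

/-- Adjacent transpositions generate the symmetric group. This is the form in which alternation
arises from inner faces, each of which compares two words differing by one adjacent transposition.
-/
theorem mem_altChains_of_swap {c : Word ι (n + 1) →₀ K} (hw : ∀ w, c w ≠ 0 → IsWord S w)
    (h : ∀ w (i : Fin n), c (permWord (Equiv.swap i.castSucc i.succ) w) = -c w) :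
    c ∈ altChains S K (n + 1) := by
  refine ⟨hw, fun w π => ?_⟩
  have hπ : π ∈ Submonoid.closure
      (Set.range fun i : Fin n => Equiv.swap i.castSucc i.succ) := by
    rw [Equiv.Perm.mclosure_swap_castSucc_succ]; trivial
  induction hπ using Submonoid.closure_induction generalizing w with
  | mem x hx =>
    obtain ⟨i, rfl⟩ := hx
    simp [h, Equiv.Perm.sign_swap (Fin.castSucc_lt_succ (i := i)).ne]
  | one => simp
  | mul x y _ _ hx hy =>
    rw [permWord_mul, hy, hx, smul_smul, Equiv.Perm.sign_mul, mul_comm]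
    simp

theorem filter_mem_altChains {c : Word ι n →₀ K} (hc : c ∈ altChains S K n) (P : Word ι n → Prop)
    [DecidablePred P] (hP : ∀ π w, P (permWord π w) ↔ P w) :
    c.filter P ∈ altChains S K n := by
  refine ⟨fun w hw => hc.1 w fun h => hw (by simp [Finsupp.filter_apply, h]), fun w π => ?_⟩
  simp only [Finsupp.filter_apply, hP, hc.2]
  split_ifs <;> simp

/-- The sign rule survives a pushforward as soon as every permutation of the new letters lifts to
one of the old letters with the same sign. -/
theorem mapDomain_mem_altChains {c : Word ι n →₀ K} (hc : c ∈ altChains S K n)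
    (f : Word ι n → Word ι m)
    (hf : ∀ π : Equiv.Perm (Fin m), ∃ π' : Equiv.Perm (Fin n),
      Equiv.Perm.sign π' = Equiv.Perm.sign π ∧ ∀ w, permWord π (f w) = f (permWord π' w))
    (hw : ∀ w, c w ≠ 0 → IsWord S (f w)) : Finsupp.mapDomain f c ∈ altChains S K m := by
  refine mem_altChains_of_mapDomain (fun w h => ?_) fun π => ?_
  · obtain ⟨a, rfl, ha⟩ := exists_of_mapDomain_ne_zero h
    exact hw a ha
  · obtain ⟨π', h₁, h₂⟩ := hf π
    rw [← Finsupp.mapDomain_comp, show permWord π ∘ f = f ∘ permWord π' from funext h₂,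
      Finsupp.mapDomain_comp, mapDomain_permWord hc, h₁]
    exact map_zsmul (Finsupp.mapDomain.addMonoidHom f) _ _

/-! ### The outer faces of words -/

open Classical in
/-- Remove the first letter from the set of the word, and delete it. -/
def firstFace (w : Word ι (n + 1)) : Word ι n := (w.1.erase (w.2 0), Fin.tail w.2)

/-- Delete the last letter. -/
def lastFace (w : Word ι (n + 1)) : Word ι n := (w.1, Fin.init w.2)

theorem IsWord.lastFace {w : Word ι (n + 1)} (h : IsWord S w) :
    IsWord S (PathHomology.lastFace w) :=
  ⟨h.face, h.inj.comp (Fin.castSucc_injective n), fun i => h.mem i.castSucc⟩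

theorem card_firstFace {w : Word ι (n + 1)} (h : IsWord S w) :
    (PathHomology.firstFace w).1.card + 1 = w.1.card := by
  classical
  simp only [PathHomology.firstFace]
  convert Finset.card_erase_add_one (h.mem 0)

theorem IsWord.firstFace {w : Word ι (n + 1)} (h : IsWord S w) (hc : 1 < w.1.card) :
    IsWord S (PathHomology.firstFace w) := by
  classical
  refine ⟨?_, h.inj.comp (Fin.succ_injective n), fun i => ?_⟩
  · refine (S.isRelLowerSet_faces h.face).2 (Finset.erase_subset _ _) ?_
    rw [← Finset.card_pos]
    have := card_firstFace h
    change 0 < (PathHomology.firstFace w).1.card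
    omega
  · simp only [PathHomology.firstFace, Fin.tail, Finset.mem_erase]
    exact ⟨fun e => Fin.succ_ne_zero i (h.inj e), h.mem _⟩

theorem exists_perm_succ (π : Equiv.Perm (Fin n)) : ∃ π' : Equiv.Perm (Fin (n + 1)),
    Equiv.Perm.sign π' = Equiv.Perm.sign π ∧ π' 0 = 0 ∧ ∀ i : Fin n, π' i.succ = (π i).succ := by
  refine ⟨π.viaFintypeEmbedding (Fin.succEmb n), Equiv.Perm.viaFintypeEmbedding_sign _ _, ?_,
    fun i => Equiv.Perm.viaFintypeEmbedding_apply_image _ _ i⟩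
  refine Equiv.Perm.viaFintypeEmbedding_apply_notMem_range _ _ ?_
  rintro ⟨i, hi⟩
  exact Fin.succ_ne_zero i hi

theorem exists_perm_castSucc (π : Equiv.Perm (Fin n)) : ∃ π' : Equiv.Perm (Fin (n + 1)),
    Equiv.Perm.sign π' = Equiv.Perm.sign π ∧ π' (Fin.last n) = Fin.last n ∧
      ∀ i : Fin n, π' i.castSucc = (π i).castSucc := by
  refine ⟨π.viaFintypeEmbedding Fin.castSuccEmb, Equiv.Perm.viaFintypeEmbedding_sign _ _, ?_,
    fun i => Equiv.Perm.viaFintypeEmbedding_apply_image _ _ i⟩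
  refine Equiv.Perm.viaFintypeEmbedding_apply_notMem_range _ _ ?_
  rintro ⟨i, hi⟩
  exact (Fin.castSucc_lt_last i).ne hi

theorem mapDomain_lastFace_mem {c : Word ι (n + 1) →₀ K} (hc : c ∈ altChains S K (n + 1)) :
    Finsupp.mapDomain lastFace c ∈ altChains S K n := by
  refine mapDomain_mem_altChains hc _ (fun π => ?_) fun w hw => (hc.1 w hw).lastFace
  obtain ⟨π', h₁, h₂, h₃⟩ := exists_perm_castSucc π
  refine ⟨π', h₁, fun w => Prod.ext rfl (funext fun i => ?_)⟩
  simp [permWord, lastFace, Fin.init, h₃]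

theorem mapDomain_firstFace_mem {c : Word ι (n + 1) →₀ K} (hc : c ∈ altChains S K (n + 1))
    (hcard : ∀ w, c w ≠ 0 → 1 < w.1.card) :
    Finsupp.mapDomain firstFace c ∈ altChains S K n := by
  refine mapDomain_mem_altChains hc _ (fun π => ?_) fun w hw => (hc.1 w hw).firstFace (hcard w hw)
  obtain ⟨π', h₁, h₂, h₃⟩ := exists_perm_succ π
  refine ⟨π', h₁, fun w => Prod.ext ?_ (funext fun i => ?_)⟩
  · simp [permWord, firstFace, h₂]
  · simp [permWord, firstFace, Fin.tail, h₃]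

/-- Swapping the last two letters changes the sign of the coefficient but not the word left after
deleting both. -/
theorem mapDomain_lastFace_lastFace {c : Word ι (n + 2) →₀ K} (hc : c ∈ altChains S K (n + 2)) :
    Finsupp.mapDomain lastFace (Finsupp.mapDomain lastFace c) = 0 := by
  rw [← Finsupp.mapDomain_comp]
  have hne : (Fin.last n).castSucc ≠ Fin.last (n + 1) := (Fin.castSucc_lt_last _).ne
  refine mapDomain_eq_zero_of_involution c _ (permWord (Equiv.swap _ _))
    (permWord_swap_swap _ _) (altChains_swap hc hne) (fun w hw => ?_) fun w _ => ?_
  · exact permWord_swap_ne (hc.1 w hw).inj hne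
  · refine Prod.ext rfl (funext fun i => ?_)
    simp only [Function.comp_apply, lastFace, permWord, Fin.init]
    rw [Equiv.swap_apply_of_ne_of_ne]
    · exact fun h => (Fin.castSucc_lt_last i).ne (Fin.castSucc_injective _ h)
    · exact (Fin.castSucc_lt_last _).ne

/-- The same cancellation, now for the first two letters: their removal from the set does not depend
on the order. -/
theorem mapDomain_firstFace_firstFace {c : Word ι (n + 2) →₀ K} (hc : c ∈ altChains S K (n + 2)) :
    Finsupp.mapDomain firstFace (Finsupp.mapDomain firstFace c) = 0 := by
  rw [← Finsupp.mapDomain_comp]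
  classical
  have hne : (0 : Fin (n + 2)) ≠ 1 := by simp
  refine mapDomain_eq_zero_of_involution c _ (permWord (Equiv.swap _ _))
    (permWord_swap_swap _ _) (altChains_swap hc hne) (fun w hw => ?_) fun w _ => ?_
  · exact permWord_swap_ne (hc.1 w hw).inj hne
  · refine Prod.ext ?_ (funext fun i => ?_)
    · have h : ∀ x : Word ι (n + 2), (firstFace (firstFace x)).1 =
          (x.1.erase (x.2 0)).erase (x.2 1) := fun x => by
        simp only [firstFace]; congr!
      rw [Function.comp_apply, Function.comp_apply, h, h]
      simp only [permWord, Function.comp_apply, Equiv.swap_apply_left, Equiv.swap_apply_right]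
      exact Finset.erase_right_comm
    · simp only [Function.comp_apply, firstFace, permWord, Fin.tail]
      rw [Equiv.swap_apply_of_ne_of_ne]
      · exact Fin.succ_ne_zero _
      · exact fun h => Fin.succ_ne_zero i (Fin.succ_injective _ h)

/-- The boundary of a linear combination of words. -/
def wordBoundary (n : ℕ) : (Word ι (n + 1) →₀ K) →ₗ[K] (Word ι n →₀ K) :=
  Finsupp.lmapDomain K K firstFace + (-1 : ℤ) ^ (n + 1) • Finsupp.lmapDomain K K lastFace

theorem wordBoundary_apply (c : Word ι (n + 1) →₀ K) :
    wordBoundary n c = Finsupp.mapDomain firstFace c +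
      (-1 : ℤ) ^ (n + 1) • Finsupp.mapDomain lastFace c := rfl

/-- The two outer faces commute, so the mixed terms cancel by their opposite signs; alternation is
needed for the squares of the faces. -/
theorem wordBoundary_wordBoundary {c : Word ι (n + 2) →₀ K} (hc : c ∈ altChains S K (n + 2)) :
    wordBoundary n (wordBoundary (n + 1) c) = 0 := by
  have h : ∀ (k : ℤ) (f : Word ι (n + 1) → Word ι n) (x : Word ι (n + 1) →₀ K),
      Finsupp.mapDomain f (k • x) = k • Finsupp.mapDomain f x := fun k f x =>
    map_zsmul (Finsupp.mapDomain.addMonoidHom f) k x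
  have h' : Finsupp.mapDomain firstFace (Finsupp.mapDomain lastFace c) =
      Finsupp.mapDomain lastFace (Finsupp.mapDomain firstFace c) := by
    rw [← Finsupp.mapDomain_comp, ← Finsupp.mapDomain_comp]
    rfl
  simp only [wordBoundary_apply, Finsupp.mapDomain_add, h, mapDomain_firstFace_firstFace hc,
    mapDomain_lastFace_lastFace hc, h', smul_zero, add_zero, zero_add, pow_succ]
  simp

end Words

/-! ### Exactness for the removal of the last letter -/

section Exactness

variable {ι : Type u} {K : Type w} [CommRing K] {n m : ℕ} {S : PreAbstractSimplicialComplex ι}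

/-- Striking out the place `i` and the value `π i` changes the sign by (-1)^(i + π i), as in a
Laplace expansion: the cycles moving `i` and `π i` to 0 have the signs (-1)^i and (-1)^(π i), and
they turn `π` into a permutation fixing 0. -/
theorem exists_perm_succAbove (π : Equiv.Perm (Fin (n + 1))) (i : Fin (n + 1)) :
    ∃ ρ : Equiv.Perm (Fin n), (∀ j, π (i.succAbove j) = (π i).succAbove (ρ j)) ∧
      ((-1 : ℤ) ^ (i : ℕ)) * (Equiv.Perm.sign ρ : ℤ) =
        (Equiv.Perm.sign π : ℤ) * (-1 : ℤ) ^ (π i : ℕ) := by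
  obtain ⟨⟨p, ρ⟩, h⟩ := Equiv.Perm.decomposeFin.symm.surjective
    ((π i).cycleRange * π * i.cycleRange⁻¹)
  have hp : p = 0 := by
    have h0 := congrArg (fun e : Equiv.Perm (Fin (n + 1)) => e 0) h
    simp only [Equiv.Perm.decomposeFin_symm_apply_zero] at h0
    rw [h0]
    simp [Equiv.Perm.mul_apply, Equiv.Perm.inv_def]
  subst hp
  refine ⟨ρ, fun j => ?_, ?_⟩
  · have hj := congrArg (fun e : Equiv.Perm (Fin (n + 1)) => (π i).cycleRange.symm (e j.succ)) h
    simp [Equiv.Perm.mul_apply, Equiv.Perm.inv_def] at hj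
    exact hj.symm
  · have hs := congrArg (fun e => ((Equiv.Perm.sign e : ℤˣ) : ℤ)) h
    simp [Equiv.Perm.decomposeFin.symm_sign] at hs
    rw [hs]
    have hi : ((-1 : ℤ) ^ (i : ℕ)) * ((-1 : ℤ) ^ (i : ℕ)) = 1 := by
      rw [← mul_pow]; simp
    linear_combination ((-1 : ℤ) ^ (π i : ℕ) * (Equiv.Perm.sign π : ℤ)) * hi

/-- Insert the letter `v σ` at the `j`-th place of a word in `σ`. -/
def insertLetter (v : Finset ι → ι) (j : Fin (n + 1)) (w : Word ι n) : Word ι (n + 1) :=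
  (w.1, j.insertNth (v w.1) w.2)

/-- Delete the `j`-th letter of a word. -/
def removeLetter (j : Fin (n + 1)) (w : Word ι (n + 1)) : Word ι n := (w.1, w.2 ∘ j.succAbove)

theorem removeLetter_insertLetter (v : Finset ι → ι) (j : Fin (n + 1)) (w : Word ι n) :
    removeLetter j (insertLetter v j w) = w :=
  Prod.ext rfl (funext fun i => by simp [removeLetter, insertLetter])

theorem insertLetter_removeLetter {v : Finset ι → ι} {j : Fin (n + 1)} {w : Word ι (n + 1)}
    (h : w.2 j = v w.1) : insertLetter v j (removeLetter j w) = w := by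
  refine Prod.ext rfl ?_
  simp only [removeLetter, insertLetter, ← h]
  exact Fin.insertNth_self_removeNth j w.2

open Classical in
theorem mapDomain_insertLetter_apply (v : Finset ι → ι) (j : Fin (n + 1)) (c : Word ι n →₀ K)
    (w : Word ι (n + 1)) : Finsupp.mapDomain (insertLetter v j) c w =
      if w.2 j = v w.1 then c (removeLetter j w) else 0 := by
  split_ifs with h
  · conv_lhs => rw [← insertLetter_removeLetter h]
    exact Finsupp.mapDomain_apply (Function.LeftInverse.injective
      (removeLetter_insertLetter v j)) _ _
  · by_contra h'
    obtain ⟨a, rfl, -⟩ := exists_of_mapDomain_ne_zero h'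
    exact h (by simp [insertLetter])

/-- The signed sum of all insertions of the letter `v σ` into words in `σ`. -/
def cone (v : Finset ι → ι) (c : Word ι n →₀ K) : Word ι (n + 1) →₀ K :=
  -- The sign is normalized to +1 at the last place `j = n`, so that deleting the last letter undoes
  -- that insertion.
  ∑ j : Fin (n + 1), (-1 : ℤ) ^ ((j : ℕ) + n) • Finsupp.mapDomain (insertLetter v j) c

open Classical in
theorem cone_apply (v : Finset ι → ι) (c : Word ι n →₀ K) (w : Word ι (n + 1)) :
    cone v c w = ∑ j : Fin (n + 1), (-1 : ℤ) ^ ((j : ℕ) + n) •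
      if w.2 j = v w.1 then c (removeLetter j w) else 0 := by
  simp only [cone, Finsupp.coe_finsetSum, Finset.sum_apply, Finsupp.smul_apply,
    mapDomain_insertLetter_apply]

theorem exists_of_cone_ne_zero {v : Finset ι → ι} {c : Word ι n →₀ K} {w : Word ι (n + 1)}
    (h : cone v c w ≠ 0) : ∃ j, w.2 j = v w.1 ∧ c (removeLetter j w) ≠ 0 := by
  classical
  rw [cone_apply] at h
  obtain ⟨j, -, hj⟩ := Finset.exists_ne_zero_of_sum_ne_zero h
  by_cases h' : w.2 j = v w.1
  · refine ⟨j, h', fun h'' => hj ?_⟩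
    rw [if_pos h', h'', smul_zero]
  · rw [if_neg h', smul_zero] at hj
    exact absurd rfl hj

/-- The letters stay distinct because the words of `c` avoid the inserted one. A permutation of the
longer word moves the place of the inserted letter, and the change of the insertion sign is the one
computed in `exists_perm_succAbove`. -/
theorem cone_mem_altChains {v : Finset ι → ι} (hv : ∀ σ ∈ S.faces, v σ ∈ σ) {c : Word ι n →₀ K}
    (hc : c ∈ altChains S K n) (hcv : ∀ w, c w ≠ 0 → ∀ i, w.2 i ≠ v w.1) :
    cone v c ∈ altChains S K (n + 1) := by
  classical
  refine ⟨fun w hw => ?_, fun w π => ?_⟩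
  · obtain ⟨j, hj, hcj⟩ := exists_of_cone_ne_zero hw
    have h₁ := hc.1 _ hcj
    have h₂ := hcv _ hcj
    refine ⟨h₁.face, fun a b hab => ?_, fun i => ?_⟩
    · rcases Fin.eq_self_or_eq_succAbove j a with ha | ⟨a, rfl⟩ <;>
        rcases Fin.eq_self_or_eq_succAbove j b with hb | ⟨b, rfl⟩
      · rw [ha, hb]
      · exact absurd (hab.symm.trans (ha ▸ hj)) (h₂ b)
      · exact absurd (hab.trans (hb ▸ hj)) (h₂ a)
      · rw [h₁.inj hab]
    · rcases Fin.eq_self_or_eq_succAbove j i with rfl | ⟨i, rfl⟩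
      · rw [hj]; exact hv _ h₁.face
      · exact h₁.mem i
  · rw [cone_apply, cone_apply,
      ← Equiv.sum_comp π (fun j : Fin (n + 1) => (-1 : ℤ) ^ ((j : ℕ) + n) •
      if w.2 j = v w.1 then c (removeLetter j w) else 0), Finset.smul_sum]
    refine Finset.sum_congr rfl fun i _ => ?_
    obtain ⟨ρ, h₁, h₂⟩ := exists_perm_succAbove π i
    have h₃ : removeLetter i (permWord π w) = permWord ρ (removeLetter (π i) w) :=
      Prod.ext rfl (funext fun j => by simp [removeLetter, permWord, h₁])
    have h₄ : (permWord π w).2 i = v (permWord π w).1 ↔ w.2 (π i) = v w.1 := Iff.rfl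
    rw [h₃, hc.2]
    simp only [h₄]
    by_cases h : w.2 (π i) = v w.1
    · rw [if_pos h, if_pos h, smul_smul, smul_smul, pow_add, pow_add, mul_right_comm, h₂, mul_assoc]
    · rw [if_neg h, if_neg h, smul_zero, smul_zero, smul_zero]

/-- An insertion elsewhere would leave `v σ` as a letter of the original word, which is impossible
for words in the support of `c`. -/
theorem cone_eq_of_last {v : Finset ι → ι} {c : Word ι n →₀ K}
    (hcv : ∀ w, c w ≠ 0 → ∀ i, w.2 i ≠ v w.1) (w : Word ι (n + 1)) (h : w.2 (Fin.last n) = v w.1) :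
    cone v c w = c (lastFace w) := by
  classical
  rw [cone_apply, Finset.sum_eq_single (Fin.last n)]
  · have : removeLetter (Fin.last n) w = lastFace w :=
      Prod.ext rfl (funext fun j => by simp [removeLetter, lastFace, Fin.init])
    rw [if_pos h, this]
    simp [← two_mul]
  · intro j _ hj
    split_ifs with h'
    · obtain ⟨k, hk⟩ := Fin.exists_succAbove_eq hj.symm
      by_contra hne
      refine hcv (removeLetter j w) (fun h0 => hne (by rw [h0, smul_zero])) k ?_
      simp [removeLetter, hk, h]
    · simp
  · simp

/-- Every word of the cone contains `v σ`; if it still avoids `v σ` after deletion of the last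
letter, then `v σ` was that letter, and only one such word lies over `w`. -/
theorem mapDomain_lastFace_cone {v : Finset ι → ι} {c : Word ι n →₀ K}
    (hcv : ∀ w, c w ≠ 0 → ∀ i, w.2 i ≠ v w.1) (w : Word ι n) (hw : ∀ i, w.2 i ≠ v w.1) :
    Finsupp.mapDomain lastFace (cone v c) w = c w := by
  classical
  have hins : lastFace (insertLetter v (Fin.last n) w) = w :=
    Prod.ext rfl (funext fun i => by simp [lastFace, insertLetter])
  rw [Finsupp.mapDomain, Finsupp.sum_apply, Finsupp.sum,
    Finset.sum_eq_single (insertLetter v (Fin.last n) w)]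
  · rw [hins, Finsupp.single_eq_same, cone_eq_of_last hcv _ (by simp [insertLetter]), hins]
  · intro w' hw' hne
    rw [Finsupp.single_apply, if_neg]
    rintro rfl
    obtain ⟨j, hj, hcj⟩ := exists_of_cone_ne_zero (Finsupp.mem_support_iff.1 hw')
    rcases Fin.eq_castSucc_or_eq_last j with ⟨j, rfl⟩ | rfl
    · exact hw j hj
    · refine hne (Prod.ext rfl (funext fun i => ?_))
      rcases Fin.eq_castSucc_or_eq_last i with ⟨i, rfl⟩ | rfl
      · simp [insertLetter, lastFace, Fin.init]
      · simp [insertLetter, lastFace, hj]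
  · intro h
    rw [Finsupp.notMem_support_iff.1 h, Finsupp.single_zero, Finsupp.zero_apply]

/-- The condition that the removal of the last letter kills a linear combination of words; it is
void if the words are empty. -/
def IsLastCycle {n : ℕ} (c : Word ι n →₀ K) : Prop :=
  match n, c with
  | 0, _ => True
  | _ + 1, c => Finsupp.mapDomain lastFace c = 0

/-- Let `w` end in `v σ`. Another word of the support with the same initial letters also contains `v
σ`, and not among these letters, so it equals `w`. Thus nothing can cancel `c w` in the last face.
Alternation moves `v σ` to the end of any other word. -/
theorem eq_zero_of_isLastCycle {v : Finset ι → ι} {c : Word ι n →₀ K}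
    (hc : c ∈ altChains S K n) (hl : IsLastCycle c) (hv : ∀ w, c w ≠ 0 → ∃ i, w.2 i = v w.1) :
    c = 0 := by
  cases n with
  | zero =>
    ext w
    by_contra h
    obtain ⟨i, -⟩ := hv w h
    exact i.elim0
  | succ n =>
    classical
    have key : ∀ w : Word ι (n + 1), w.2 (Fin.last n) = v w.1 → c w = 0 := by
      intro w hw
      by_contra hne
      have h := congrArg (fun c => c (lastFace w)) (show Finsupp.mapDomain lastFace c = 0 from hl)
      simp only [Finsupp.mapDomain, Finsupp.sum, Finsupp.coe_finsetSum, Finset.sum_apply,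
        Finsupp.zero_apply] at h
      rw [Finset.sum_eq_single w] at h
      · rw [Finsupp.single_eq_same] at h
        exact hne h
      · intro w' hw' hne'
        rw [Finsupp.single_eq_of_ne']
        intro he
        have h₁ : w'.1 = w.1 := congrArg (fun x : Word ι n => x.1) he
        have h₂ : ∀ i : Fin n, w'.2 i.castSucc = w.2 i.castSucc :=
          fun i => congrFun (congrArg (fun x : Word ι n => x.2) he) i
        obtain ⟨i, hi⟩ := hv w' (Finsupp.mem_support_iff.1 hw')
        rw [h₁, ← hw] at hi
        refine hne' (Prod.ext h₁ (funext fun j => ?_))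
        rcases Fin.eq_castSucc_or_eq_last i with ⟨i, rfl⟩ | rfl
        · rw [h₂] at hi
          exact absurd ((hc.1 w hne).inj hi) (Fin.castSucc_lt_last i).ne
        · rcases Fin.eq_castSucc_or_eq_last j with ⟨j, rfl⟩ | rfl
          · exact h₂ j
          · exact hi
      · intro h
        rw [Finsupp.notMem_support_iff.1 h, Finsupp.single_zero, Finsupp.zero_apply]
    ext w
    by_contra hne
    obtain ⟨i, hi⟩ := hv w hne
    have h := key (permWord (Equiv.swap i (Fin.last n)) w) (by simp [permWord, hi])
    rw [hc.2] at h
    rcases Int.units_eq_one_or (Equiv.Perm.sign (Equiv.swap i (Fin.last n))) with h' | h' <;>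
      rw [h'] at h <;> simp at h <;> exact hne h

theorem isLastCycle_sub {c c' : Word ι n →₀ K} (h : IsLastCycle c) (h' : IsLastCycle c') :
    IsLastCycle (c - c') := by
  cases n with
  | zero => trivial
  | succ n =>
    change Finsupp.lmapDomain K K lastFace (c - c') = 0
    rw [map_sub]
    change Finsupp.mapDomain lastFace c - Finsupp.mapDomain lastFace c' = 0
    rw [show Finsupp.mapDomain lastFace c = 0 from h,
      show Finsupp.mapDomain lastFace c' = 0 from h', sub_zero]

/-- The cone over the part of `c` avoiding `v σ` has a last face that agrees with `c` on the words
avoiding `v σ`. The difference is a cycle supported on words containing `v σ`, hence zero. Empty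
words count as cycles because the complex of each σ is exact down to degree 0. The last clause keeps
the sets of `y` among those of `c`, which controls their sizes later. -/
theorem exists_mapDomain_lastFace_eq {c : Word ι n →₀ K} (hc : c ∈ altChains S K n)
    (hl : IsLastCycle c) : ∃ y ∈ altChains S K (n + 1), Finsupp.mapDomain lastFace y = c ∧
      ∀ w, y w ≠ 0 → ∃ w', c w' ≠ 0 ∧ w'.1 = w.1 := by
  classical
  by_cases hc' : c = 0
  · refine ⟨0, zero_mem _, ?_, fun w hw => absurd rfl hw⟩
    rw [hc', Finsupp.mapDomain_zero]
  obtain ⟨v, hv⟩ : ∃ v : Finset ι → ι, ∀ σ ∈ S.faces, v σ ∈ σ := by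
    obtain ⟨w, hw⟩ := Finsupp.ne_iff.1 hc'
    obtain ⟨a, -⟩ := (S.isRelLowerSet_faces (hc.1 w hw).face).1
    -- All simplices are non-empty, so the default `a` plays no role.
    refine ⟨fun σ => if h : σ.Nonempty then h.choose else a, fun σ hσ => ?_⟩
    have h := (S.isRelLowerSet_faces hσ).1
    simp only [dif_pos h]
    exact h.choose_spec
  set c₀ := c.filter fun w => ∀ i, w.2 i ≠ v w.1 with hc₀
  have hc₀m : c₀ ∈ altChains S K n := filter_mem_altChains hc _ fun π w =>
    ⟨fun h i => by simpa [permWord] using h (π⁻¹ i), fun h i => h (π i)⟩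
  have hc₀v : ∀ w, c₀ w ≠ 0 → ∀ i, w.2 i ≠ v w.1 := fun w hw => by
    by_contra h
    exact hw (Finsupp.filter_apply_neg _ _ h)
  have hy := cone_mem_altChains hv hc₀m hc₀v
  refine ⟨cone v c₀, hy, ?_, fun w hw => ?_⟩
  · symm
    rw [← sub_eq_zero]
    refine eq_zero_of_isLastCycle (v := v) (sub_mem hc (mapDomain_lastFace_mem hy))
      (isLastCycle_sub hl ?_) fun w hw => ?_
    · cases n with
      | zero => trivial
      | succ n => exact mapDomain_lastFace_lastFace hy
    · by_contra! h
      refine hw ?_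
      rw [Finsupp.sub_apply, mapDomain_lastFace_cone hc₀v w h, hc₀,
        Finsupp.filter_apply_pos _ _ h, sub_self]
  · obtain ⟨j, -, hj⟩ := exists_of_cone_ne_zero hw
    refine ⟨removeLetter j w, fun h => hj ?_, rfl⟩
    rw [hc₀, Finsupp.filter_apply, h, ite_self]

end Exactness

/-! ### Cubical chains and full chains -/

section CubeChains

variable {ι : Type u} {K : Type w} [CommRing K] {n m : ℕ} {S : PreAbstractSimplicialComplex ι}

/-- The alternating chains on words that do not exhaust the simplex. -/
def cubeChains (S : PreAbstractSimplicialComplex ι) (K : Type w) [CommRing K] (n : ℕ) :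
    Submodule K (Word ι n →₀ K) :=
  altChains S K n ⊓ Finsupp.supported K K {w | n < w.1.card}

/-- The alternating chains on words that exhaust the simplex. -/
def fullChains (S : PreAbstractSimplicialComplex ι) (K : Type w) [CommRing K] (n : ℕ) :
    Submodule K (Word ι n →₀ K) :=
  altChains S K n ⊓ Finsupp.supported K K {w | w.1.card = n}

theorem mem_cubeChains {c : Word ι n →₀ K} :
    c ∈ cubeChains S K n ↔ c ∈ altChains S K n ∧ ∀ w, c w ≠ 0 → n < w.1.card := by
  simp only [cubeChains, Submodule.mem_inf, Finsupp.mem_supported, Set.subset_def,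
    Finset.mem_coe, Finsupp.mem_support_iff, Set.mem_ofPred_eq]

theorem mem_fullChains {c : Word ι n →₀ K} :
    c ∈ fullChains S K n ↔ c ∈ altChains S K n ∧ ∀ w, c w ≠ 0 → w.1.card = n := by
  simp only [fullChains, Submodule.mem_inf, Finsupp.mem_supported, Set.subset_def,
    Finset.mem_coe, Finsupp.mem_support_iff, Set.mem_ofPred_eq]

/-! ### The outer faces and the size of the underlying set -/

theorem card_of_mapDomain_firstFace_ne_zero {c : Word ι (n + 1) →₀ K}
    (hc : c ∈ altChains S K (n + 1)) {w : Word ι n} (h : Finsupp.mapDomain firstFace c w ≠ 0) :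
    ∃ w', c w' ≠ 0 ∧ w'.1.card = w.1.card + 1 := by
  obtain ⟨w', rfl, h'⟩ := exists_of_mapDomain_ne_zero h
  exact ⟨w', h', (card_firstFace (hc.1 _ h')).symm⟩

theorem card_of_mapDomain_lastFace_ne_zero {c : Word ι (n + 1) →₀ K} {w : Word ι n}
    (h : Finsupp.mapDomain lastFace c w ≠ 0) : ∃ w', c w' ≠ 0 ∧ w'.1.card = w.1.card := by
  obtain ⟨w', rfl, h'⟩ := exists_of_mapDomain_ne_zero h
  exact ⟨w', h', rfl⟩

theorem wordBoundary_mem_cubeChains {c : Word ι (n + 1) →₀ K} (hc : c ∈ cubeChains S K (n + 1)) :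
    wordBoundary n c ∈ cubeChains S K n := by
  rw [mem_cubeChains] at hc
  rw [wordBoundary_apply]
  refine add_mem (mem_cubeChains.2 ⟨mapDomain_firstFace_mem hc.1 fun w hw => ?_, fun w hw => ?_⟩)
    (zsmul_mem (mem_cubeChains.2 ⟨mapDomain_lastFace_mem hc.1, fun w hw => ?_⟩) _)
  · have := hc.2 w hw
    omega
  · obtain ⟨w', h₁, h₂⟩ := card_of_mapDomain_firstFace_ne_zero hc.1 hw
    have := hc.2 w' h₁
    omega
  · obtain ⟨w', h₁, h₂⟩ := card_of_mapDomain_lastFace_ne_zero hw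
    have := hc.2 w' h₁
    omega

/-- The condition that the boundary is supported on words that exhaust the simplex up to one
element. -/
def HasFullBoundary {n : ℕ} (c : Word ι n →₀ K) : Prop :=
  match n, c with
  | 0, _ => True
  -- Words of the boundary have `n` letters, and an oriented `n`-simplex gives words of `n` letters
  -- in a set of `n + 1` elements.
  | n + 1, c => ∀ w, wordBoundary n c w ≠ 0 → w.1.card = n + 1

/-- The first face lowers the size of the set by one and the last face preserves it. So at the top
size `p` the boundary is, up to sign, the last face of the top layer; `p` is too large for
`HasFullBoundary` to allow it to be non-zero. -/
theorem isLastCycle_filter {c : Word ι n →₀ K} (hc : c ∈ cubeChains S K n)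
    (hb : HasFullBoundary c) {p : ℕ} (hp : n < p) (hcp : ∀ w, c w ≠ 0 → w.1.card ≤ p) :
    IsLastCycle (c.filter fun w => w.1.card = p) := by
  cases n with
  | zero => trivial
  | succ n =>
    rw [mem_cubeChains] at hc
    change Finsupp.mapDomain lastFace _ = 0
    ext w
    by_contra hne
    have hw : w.1.card = p := by
      obtain ⟨w', h₁, h₂⟩ := card_of_mapDomain_lastFace_ne_zero hne
      rw [← h₂]
      by_contra h
      exact h₁ (Finsupp.filter_apply_neg _ _ h)
    have h₁ : Finsupp.mapDomain firstFace c w = 0 := by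
      by_contra h
      obtain ⟨w', h₁, h₂⟩ := card_of_mapDomain_firstFace_ne_zero hc.1 h
      have := hcp w' h₁
      omega
    have h₂ : Finsupp.mapDomain lastFace (c.filter fun w => ¬ w.1.card = p) w = 0 := by
      by_contra h
      obtain ⟨w', h₁, h₂⟩ := card_of_mapDomain_lastFace_ne_zero h
      refine h₁ (Finsupp.filter_apply_neg _ _ ?_)
      simp [h₂, hw]
    have h₃ : wordBoundary n c w = (-1 : ℤ) ^ (n + 1) •
        Finsupp.mapDomain lastFace (c.filter fun w => w.1.card = p) w := by
      rw [wordBoundary_apply, Finsupp.add_apply, h₁, zero_add, Finsupp.smul_apply]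
      conv_lhs => rw [← Finsupp.filter_add_filter_not c fun w => w.1.card = p,
        Finsupp.mapDomain_add, Finsupp.add_apply, h₂, add_zero]
    have h₄ := hb w (by
      rw [h₃]
      rcases neg_one_pow_eq_or ℤ (n + 1) with h | h <;> rw [h] <;> simpa using hne)
    omega

theorem hasFullBoundary_sub {c : Word ι n →₀ K} (hb : HasFullBoundary c) {y : Word ι (n + 1) →₀ K}
    (hy : y ∈ altChains S K (n + 1)) : HasFullBoundary (c - wordBoundary n y) := by
  cases n with
  | zero => trivial
  | succ n =>
    change ∀ w, wordBoundary n (c - wordBoundary (n + 1) y) w ≠ 0 → w.1.card = n + 1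
    rw [map_sub, wordBoundary_wordBoundary hy, sub_zero]
    exact hb

/-- Induction on the excess `p` of the largest set over `n + 1` elements. The top layer is the last
face of some `y` on the same sets. For positive excess `y` is a cube chain, and subtracting a signed
boundary of `y` trades the top layer for first faces, whose sets are smaller by one. For excess zero
the words of `y` exhaust their sets, and `y` becomes the full chain `z`. -/
theorem exists_eq_wordBoundary_add_of_card_le (p : ℕ) : ∀ {c : Word ι n →₀ K},
    c ∈ cubeChains S K n → HasFullBoundary c → (∀ w, c w ≠ 0 → w.1.card ≤ n + 1 + p) →
    ∃ y ∈ cubeChains S K (n + 1), ∃ z ∈ fullChains S K (n + 1),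
      c = wordBoundary n y + Finsupp.mapDomain lastFace z := by
  classical
  induction p with
  | zero =>
    intro c hc hb hp
    have h := isLastCycle_filter hc hb (Nat.lt_succ_self n) hp
    rw [mem_cubeChains] at hc
    have hcard : ∀ w, c w ≠ 0 → w.1.card = n + 1 := fun w hw => by
      have := hc.2 w hw
      have := hp w hw
      omega
    have hfil : (c.filter fun w => w.1.card = n + 1) = c :=
      Finsupp.filter_eq_self_iff _ _ |>.2 hcard
    rw [Nat.succ_eq_add_one, hfil] at h
    obtain ⟨z, hz, rfl, hz'⟩ := exists_mapDomain_lastFace_eq hc.1 h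
    refine ⟨0, zero_mem _, z, mem_fullChains.2 ⟨hz, fun w hw => ?_⟩, by simp⟩
    obtain ⟨w', h₁, h₂⟩ := hz' w hw
    rw [← h₂, hcard w' h₁]
  | succ p ih =>
    intro c hc hb hp
    have h := isLastCycle_filter hc hb (p := n + 1 + (p + 1)) (by omega) hp
    set d := c.filter fun w => w.1.card = n + 1 + (p + 1) with hd
    have hdm : d ∈ altChains S K n :=
      filter_mem_altChains (mem_cubeChains.1 hc).1 _ fun π w => Iff.rfl
    obtain ⟨y, hy, hyd, hy'⟩ := exists_mapDomain_lastFace_eq hdm h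
    have hycard : ∀ w, y w ≠ 0 → w.1.card = n + 1 + (p + 1) := fun w hw => by
      obtain ⟨w', h₁, h₂⟩ := hy' w hw
      rw [← h₂]
      by_contra h
      exact h₁ (Finsupp.filter_apply_neg _ _ h)
    have hym : y ∈ cubeChains S K (n + 1) := mem_cubeChains.2 ⟨hy, fun w hw => by
      have := hycard w hw
      omega⟩
    -- This sign makes the last-face term of the boundary of `y₁` equal to `d` itself.
    set y₁ := (-1 : ℤ) ^ (n + 1) • y with hy₁
    have hy₁m : y₁ ∈ cubeChains S K (n + 1) := zsmul_mem hym _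
    have hdy : wordBoundary n y₁ = (-1 : ℤ) ^ (n + 1) • Finsupp.mapDomain firstFace y + d := by
      rw [hy₁, map_zsmul, wordBoundary_apply, hyd, smul_add, smul_smul, ← mul_pow]
      simp
    obtain ⟨y₂, hy₂, z, hz, h⟩ := ih (c := c - wordBoundary n y₁)
      (sub_mem hc (wordBoundary_mem_cubeChains hy₁m))
      (hasFullBoundary_sub hb (mem_cubeChains.1 hy₁m).1) (fun w hw => by
        rw [hdy, Finsupp.sub_apply, Finsupp.add_apply, Finsupp.smul_apply] at hw
        by_contra hcard
        have h₁ : Finsupp.mapDomain firstFace y w = 0 := by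
          by_contra h
          obtain ⟨w', h₁, h₂⟩ := card_of_mapDomain_firstFace_ne_zero hy h
          have := hycard w' h₁
          omega
        rw [h₁, smul_zero, zero_add] at hw
        by_cases h : w.1.card = n + 1 + (p + 1)
        · rw [hd, Finsupp.filter_apply_pos (fun w : Word ι n => w.1.card = n + 1 + (p + 1)) _ h,
            sub_self] at hw
          exact hw rfl
        · rw [hd, Finsupp.filter_apply_neg (fun w : Word ι n => w.1.card = n + 1 + (p + 1)) _ h,
            sub_zero] at hw
          have := hp w hw
          omega)
    refine ⟨y₁ + y₂, add_mem hy₁m hy₂, z, hz, ?_⟩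
    rw [map_add, add_assoc, ← h]
    abel

theorem exists_eq_wordBoundary_add {c : Word ι n →₀ K} (hc : c ∈ cubeChains S K n)
    (hb : HasFullBoundary c) : ∃ y ∈ cubeChains S K (n + 1), ∃ z ∈ fullChains S K (n + 1),
      c = wordBoundary n y + Finsupp.mapDomain lastFace z := by
  classical
  -- Any bound on the finitely many set sizes will do; the largest size itself is a generous one for
  -- the excess.
  refine exists_eq_wordBoundary_add_of_card_le (c.support.sup fun w => w.1.card) hc hb
    fun w hw => ?_
  have := Finset.le_sup (f := fun w : Word ι n => w.1.card) (Finsupp.mem_support_iff.2 hw)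
  change w.1.card ≤ _ at this
  omega

/-! ### Antisymmetrization of ordered simplices -/

open Classical in
/-- The word formed by all the letters of a sequence. -/
def fullWord (f : Fin m → ι) : Word ι m := (Finset.univ.image f, f)

variable (K) in
/-- The alternating sum of all the orderings of an ordered simplex. -/
def antisymm (f : Fin m → ι) : Word ι m →₀ K :=
  ∑ π : Equiv.Perm (Fin m), ((Equiv.Perm.sign π : ℤˣ) : ℤ) •
    Finsupp.single (permWord π (fullWord f)) 1

theorem fullWord_comp (f : Fin m → ι) (π : Equiv.Perm (Fin m)) :
    fullWord (f ∘ π) = permWord π (fullWord f) := by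
  classical
  refine Prod.ext ?_ rfl
  ext a
  simp only [fullWord, permWord, Finset.mem_image, Finset.mem_univ, true_and, Function.comp_apply]
  exact (π.surjective.exists (p := fun i => f i = a)).symm

theorem antisymm_comp (f : Fin m → ι) (ρ : Equiv.Perm (Fin m)) :
    antisymm K (f ∘ ρ) = ((Equiv.Perm.sign ρ : ℤˣ) : ℤ) • antisymm K f := by
  rw [antisymm, antisymm, Finset.smul_sum]
  refine Fintype.sum_equiv (Equiv.mulLeft ρ) _ _ fun π => ?_
  rw [fullWord_comp, ← permWord_mul, smul_smul, Equiv.coe_mulLeft, Equiv.Perm.sign_mul,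
    Units.val_mul, ← mul_assoc, ← Units.val_mul, Int.units_mul_self, Units.val_one, one_mul]

/-- The transposition of two places with equal entries pairs each ordering with one that gives the
same word and the opposite sign. -/
theorem antisymm_eq_zero {f : Fin m → ι} (hf : ¬ Function.Injective f) : antisymm K f = 0 := by
  obtain ⟨a, b, hab, hne⟩ : ∃ a b, f a = f b ∧ a ≠ b := by
    simpa [Function.Injective] using hf
  have hsw : f ∘ Equiv.swap a b = f := by
    funext j
    rw [Function.comp_apply]
    by_cases ha : j = a
    · rw [ha, Equiv.swap_apply_left, hab]
    by_cases hb : j = b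
    · rw [hb, Equiv.swap_apply_right, hab]
    rw [Equiv.swap_apply_of_ne_of_ne ha hb]
  refine Finset.sum_involution (fun π _ => Equiv.swap a b * π) (fun π _ => ?_) (fun π _ _ h => ?_)
    (fun _ _ => Finset.mem_univ _) (fun π _ => Equiv.swap_mul_self_mul _ _ _)
  · rw [permWord_mul, ← fullWord_comp f (Equiv.swap a b), hsw, Equiv.Perm.sign_mul,
      Equiv.Perm.sign_swap hne]
    simp
  · rw [mul_eq_right] at h
    exact hne (Equiv.swap_eq_one_iff.1 h)

theorem permWord_fullWord_injective {f : Fin m → ι} (hf : Function.Injective f) :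
    Function.Injective fun π : Equiv.Perm (Fin m) => permWord π (fullWord f) := by
  intro π ρ h
  refine Equiv.ext fun i => hf ?_
  exact congrFun (congrArg (fun x : Word ι m => x.2) h) i

theorem antisymm_apply_permWord {f : Fin m → ι} (hf : Function.Injective f)
    (ρ : Equiv.Perm (Fin m)) :
    antisymm K f (permWord ρ (fullWord f)) = (((Equiv.Perm.sign ρ : ℤˣ) : ℤ) : K) := by
  rw [antisymm, Finsupp.coe_finsetSum, Finset.sum_apply, Finset.sum_eq_single ρ]
  · simp
  · intro π _ hne
    rw [Finsupp.smul_apply, Finsupp.single_eq_of_ne', smul_zero]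
    exact fun h => hne (permWord_fullWord_injective hf h)
  · simp

theorem exists_of_antisymm_ne_zero {f : Fin m → ι} {w : Word ι m} (h : antisymm K f w ≠ 0) :
    ∃ π, w = permWord π (fullWord f) := by
  rw [antisymm, Finsupp.coe_finsetSum, Finset.sum_apply] at h
  obtain ⟨π, -, hπ⟩ := Finset.exists_ne_zero_of_sum_ne_zero h
  refine ⟨π, ?_⟩
  by_contra hne
  exact hπ (by rw [Finsupp.smul_apply, Finsupp.single_eq_of_ne hne, smul_zero])

theorem isWord_fullWord {f : Fin m → ι} (hf : Function.Injective f)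
    (hS : (fullWord f).1 ∈ S.faces) : IsWord S (fullWord f) := by
  classical
  exact ⟨hS, hf, fun i => Finset.mem_image_of_mem _ (Finset.mem_univ i)⟩

theorem card_fullWord {f : Fin m → ι} (hf : Function.Injective f) : (fullWord f).1.card = m := by
  classical
  simp only [fullWord]
  rw [Finset.card_image_of_injective _ hf, Finset.card_univ, Fintype.card_fin]

theorem fullWord_face {σ : Finset ι} (hσ : σ ∈ S.faces) {f : Fin (m + 1) → ι}
    (hf : ∀ i, f i ∈ σ) : (fullWord f).1 ∈ S.faces := by
  classical
  refine (S.isRelLowerSet_faces hσ).2 (Finset.image_subset_iff.2 fun i _ => hf i) ?_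
  exact ⟨f 0, Finset.mem_image_of_mem _ (Finset.mem_univ 0)⟩

theorem fullWord_of_isWord {w : Word ι m} (hw : IsWord S w) (hm : w.1.card = m) :
    fullWord w.2 = w := by
  classical
  refine Prod.ext (Finset.eq_of_subset_of_card_le (Finset.image_subset_iff.2 fun i _ => hw.mem i)
    ?_) rfl
  rw [hm]
  exact (card_fullWord hw.inj).ge

theorem antisymm_mem_fullChains {f : Fin m → ι} (hf : Function.Injective f)
    (hS : (fullWord f).1 ∈ S.faces) : antisymm K f ∈ fullChains S K m := by
  refine mem_fullChains.2 ⟨⟨fun w hw => ?_, fun w π => ?_⟩, fun w hw => ?_⟩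
  · obtain ⟨π, rfl⟩ := exists_of_antisymm_ne_zero hw
    exact (isWord_fullWord hf hS).perm π
  · by_cases h : ∃ ρ, w = permWord ρ (fullWord f)
    · obtain ⟨ρ, rfl⟩ := h
      rw [← permWord_mul, antisymm_apply_permWord hf, antisymm_apply_permWord hf,
        Equiv.Perm.sign_mul, mul_comm, Units.val_mul, Int.cast_mul, zsmul_eq_mul]
    · have h₁ : antisymm K f w = 0 := by
        by_contra h'
        exact h (exists_of_antisymm_ne_zero h')
      have h₂ : antisymm K f (permWord π w) = 0 := by
        by_contra h'
        obtain ⟨ρ, hρ⟩ := exists_of_antisymm_ne_zero h'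
        refine h ⟨ρ * π⁻¹, ?_⟩
        rw [permWord_mul, ← hρ, ← permWord_mul]
        simp
      rw [h₁, h₂, smul_zero]
  · obtain ⟨π, rfl⟩ := exists_of_antisymm_ne_zero hw
    exact card_fullWord hf

/-- Two full chains agree as soon as they agree for one ordering of each simplex. -/
theorem fullChains_ext {e : Finset ι → Fin m → ι}
    (he : ∀ σ : Finset ι, σ.card = m → fullWord (e σ) = (σ, e σ) ∧ Function.Injective (e σ))
    {c c' : Word ι m →₀ K} (hc : c ∈ fullChains S K m) (hc' : c' ∈ fullChains S K m)
    (h : ∀ σ ∈ S.faces, σ.card = m → c (σ, e σ) = c' (σ, e σ)) : c = c' := by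
  rw [← sub_eq_zero]
  have hd := mem_fullChains.1 (sub_mem hc hc')
  ext w
  by_contra hne
  have h₁ := hd.1.1 w hne
  have h₂ := hd.2 w hne
  obtain ⟨h₃, h₄⟩ := he w.1 h₂
  have : ∃ π : Equiv.Perm (Fin m), e w.1 ∘ π = w.2 := by
    classical
    have hex : ∀ i, ∃ j, e w.1 j = w.2 i := fun i => by
      have := h₁.mem i
      have h₅ : (fullWord (e w.1)).1 = w.1 := by rw [h₃]
      rw [← h₅] at this
      simpa [fullWord] using this
    choose g hg using hex
    have hgi : Function.Injective g := fun i j hij => h₁.inj (by rw [← hg, ← hg, hij])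
    exact ⟨Equiv.ofBijective g (Finite.injective_iff_bijective.1 hgi), funext hg⟩
  obtain ⟨π, hπ⟩ := this
  have hw : w = permWord π (w.1, e w.1) := Prod.ext rfl hπ.symm
  rw [hw, hd.1.2, Finsupp.sub_apply, h w.1 h₁.face h₂, sub_self, smul_zero] at hne
  exact hne rfl

variable (ι m) in
theorem exists_enumeration [Nonempty ι] : ∃ e : Finset ι → Fin m → ι,
    ∀ σ : Finset ι, σ.card = m → fullWord (e σ) = (σ, e σ) ∧ Function.Injective (e σ) := by
  classical
  have : ∀ σ : Finset ι, ∃ f : Fin m → ι, σ.card = m →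
      fullWord f = (σ, f) ∧ Function.Injective f := by
    intro σ
    by_cases h : σ.card = m
    · refine ⟨fun i => ((σ.equivFinOfCardEq h).symm i : ι), fun _ => ⟨Prod.ext ?_ rfl, ?_⟩⟩
      · ext a
        simp only [fullWord, Finset.mem_image, Finset.mem_univ, true_and]
        constructor
        · rintro ⟨i, rfl⟩
          exact Subtype.prop _
        · intro ha
          exact ⟨σ.equivFinOfCardEq h ⟨a, ha⟩, by simp⟩
      · exact Subtype.val_injective.comp (Equiv.injective _)
    -- A junk value for sets of the wrong size; this is the only use of `Nonempty ι`.
    · exact ⟨fun _ => Classical.arbitrary ι, fun h' => absurd h' h⟩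
  choose e he using this
  exact ⟨e, he⟩

/-- A full chain is determined by its coefficient at one ordering of each simplex, and `antisymm`
has coefficient 1 at its own ordering. Hence no factorial has to be inverted. -/
theorem fullChains_le_span : fullChains S K m ≤ Submodule.span K
    {c | ∃ f : Fin m → ι, Function.Injective f ∧ (fullWord f).1 ∈ S.faces ∧ c = antisymm K f} := by
  classical
  intro c hc
  by_cases hc₀ : c = 0
  · rw [hc₀]; exact zero_mem _
  have : Nonempty ι := by
    obtain ⟨w, hw⟩ := Finsupp.ne_iff.1 hc₀
    exact (S.isRelLowerSet_faces ((mem_fullChains.1 hc).1.1 w hw).face).1.to_type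
  obtain ⟨e, he⟩ := exists_enumeration ι m
  have hsupp : ∀ σ ∈ c.support.image Prod.fst, σ ∈ S.faces ∧ σ.card = m := by
    intro σ hσ
    obtain ⟨w, hw, rfl⟩ := Finset.mem_image.1 hσ
    exact ⟨((mem_fullChains.1 hc).1.1 w (Finsupp.mem_support_iff.1 hw)).face,
      (mem_fullChains.1 hc).2 w (Finsupp.mem_support_iff.1 hw)⟩
  have hmem : ∀ σ ∈ S.faces, σ.card = m → antisymm K (e σ) ∈ fullChains S K m := by
    intro σ hσ hm
    refine antisymm_mem_fullChains (he σ hm).2 ?_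
    rw [(he σ hm).1]
    exact hσ
  have heq : c = ∑ σ ∈ c.support.image Prod.fst, c (σ, e σ) • antisymm K (e σ) := by
    refine fullChains_ext he hc (Submodule.sum_mem _ fun σ hσ => Submodule.smul_mem _ _ ?_)
      fun σ hσ hm => ?_
    · exact hmem σ (hsupp σ hσ).1 (hsupp σ hσ).2
    · rw [Finsupp.coe_finsetSum, Finset.sum_apply, Finset.sum_eq_single σ]
      · have := antisymm_apply_permWord (K := K) (he σ hm).2 1
        rw [permWord_one, (he σ hm).1] at this
        rw [Finsupp.smul_apply, this]
        simp
      · intro τ hτ hne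
        rw [Finsupp.smul_apply]
        by_contra h
        obtain ⟨π, hπ⟩ := exists_of_antisymm_ne_zero (right_ne_zero_of_smul h)
        rw [(he τ (hsupp τ hτ).2).1] at hπ
        exact hne (congrArg Prod.fst hπ).symm
      · intro h
        rw [Finsupp.smul_apply]
        by_contra hne
        refine h (Finset.mem_image_of_mem Prod.fst (Finsupp.mem_support_iff.2
          (left_ne_zero_of_smul hne)))
  rw [heq]
  refine Submodule.sum_mem _ fun σ hσ => Submodule.smul_mem _ _ (Submodule.subset_span ?_)
  obtain ⟨h₁, h₂⟩ := hsupp σ hσ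
  refine ⟨e σ, (he σ h₂).2, ?_, rfl⟩
  rw [(he σ h₂).1]
  exact h₁

/-- In a word that exhausts its set, the last letter is the one element missing among the others, so
it can be recovered. -/
theorem mapDomain_lastFace_injective {c : Word ι (n + 1) →₀ K} (hc : c ∈ fullChains S K (n + 1))
    (h : Finsupp.mapDomain lastFace c = 0) : c = 0 := by
  classical
  rw [mem_fullChains] at hc
  have hinj : Set.InjOn (lastFace : Word ι (n + 1) → Word ι n)
      {w | IsWord S w ∧ w.1.card = n + 1} := by
    rintro w ⟨hw, hwc⟩ w' ⟨hw', hwc'⟩ he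
    have h₁ : w.1 = w'.1 := congrArg (fun x : Word ι n => x.1) he
    have h₂ : ∀ i : Fin n, w.2 i.castSucc = w'.2 i.castSucc :=
      fun i => congrFun (congrArg (fun x : Word ι n => x.2) he) i
    refine Prod.ext h₁ (funext fun i => ?_)
    rcases Fin.eq_castSucc_or_eq_last i with ⟨i, rfl⟩ | rfl
    · exact h₂ i
    · have h₃ : w.2 (Fin.last n) ∈ (fullWord w'.2).1 := by
        rw [fullWord_of_isWord hw' hwc', ← h₁]
        exact hw.mem _
      simp only [fullWord, Finset.mem_image, Finset.mem_univ, true_and] at h₃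
      obtain ⟨j, hj⟩ := h₃
      rcases Fin.eq_castSucc_or_eq_last j with ⟨j, rfl⟩ | rfl
      · rw [← h₂] at hj
        exact absurd (hw.inj hj) (Fin.castSucc_lt_last j).ne
      · exact hj.symm
  refine Finsupp.mapDomain_injOn _ hinj (x₁ := c) (x₂ := 0) ?_ ?_ (by simpa using h)
  · intro w hw
    exact ⟨hc.1.1 w (Finsupp.mem_support_iff.1 hw), hc.2 w (Finsupp.mem_support_iff.1 hw)⟩
  · simp

/-- Sort the orderings by their first letter `f i`. What follows is an ordering of the remaining
letters, and bringing `f i` to the front costs the sign (-1)^i. -/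
theorem mapDomain_firstFace_antisymm {f : Fin (n + 1) → ι} (hf : Function.Injective f) :
    Finsupp.mapDomain firstFace (antisymm K f) =
      ∑ i : Fin (n + 1), (-1 : ℤ) ^ (i : ℕ) • antisymm K (f ∘ i.succAbove) := by
  classical
  have h₀ : ∀ i : Fin (n + 1), (fullWord (f ∘ i.succAbove)).1 = (fullWord f).1.erase (f i) := by
    intro i
    ext a
    simp only [fullWord, Finset.mem_image, Finset.mem_univ, true_and, Finset.mem_erase,
      Function.comp_apply]
    constructor
    · rintro ⟨j, rfl⟩
      exact ⟨fun h => Fin.succAbove_ne i j (hf h), _, rfl⟩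
    · rintro ⟨hne, j, rfl⟩
      obtain ⟨k, hk⟩ := Fin.exists_succAbove_eq (x := j) (y := i) (fun h => hne (by rw [h]))
      exact ⟨k, by rw [hk]⟩
  -- `E (i, ρ)` sends 0 to `i` and acts as `ρ` from the other places onto the complement of `i`.
  let E : Fin (n + 1) × Equiv.Perm (Fin n) → Equiv.Perm (Fin (n + 1)) := fun p =>
    p.1.cycleRange.symm * Equiv.Perm.decomposeFin.symm (0, p.2)
  have hE₀ : ∀ p, E p 0 = p.1 := fun p => by simp [E]
  have hE₁ : ∀ p j, E p (Fin.succ j) = p.1.succAbove (p.2 j) := fun p j => by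
    simp [E]
  have hE : Function.Bijective E := by
    rw [Fintype.bijective_iff_injective_and_card]
    constructor
    · intro p q h
      have h₁ : p.1 = q.1 := by rw [← hE₀, h, hE₀]
      refine Prod.ext h₁ (Equiv.ext fun j => ?_)
      have := hE₁ p j
      rw [h, hE₁, h₁] at this
      exact (Fin.succAbove_right_injective this).symm
    · simp [Fintype.card_perm, Nat.factorial_succ]
  have hsign : ∀ p, ((Equiv.Perm.sign (E p) : ℤˣ) : ℤ) =
      (-1 : ℤ) ^ (p.1 : ℕ) * ((Equiv.Perm.sign p.2 : ℤˣ) : ℤ) := fun p => by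
    simp [E, Equiv.Perm.decomposeFin.symm_sign]
  have hlhs : Finsupp.mapDomain firstFace (antisymm K f) = ∑ π : Equiv.Perm (Fin (n + 1)),
      ((Equiv.Perm.sign π : ℤˣ) : ℤ) •
        Finsupp.single (firstFace (permWord π (fullWord f))) (1 : K) := by
    change Finsupp.mapDomain.addMonoidHom firstFace _ = _
    rw [antisymm, map_sum]
    refine Finset.sum_congr rfl fun π _ => ?_
    rw [map_zsmul]
    exact congrArg _ Finsupp.mapDomain_single
  rw [hlhs, ← Function.Bijective.sum_comp hE, Fintype.sum_prod_type]
  refine Finset.sum_congr rfl fun i _ => ?_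
  rw [antisymm, Finset.smul_sum]
  refine Finset.sum_congr rfl fun ρ _ => ?_
  rw [hsign, smul_smul]
  congr 2
  refine Prod.ext ?_ (funext fun j => ?_)
  · simp only [firstFace, permWord, h₀, Function.comp_apply, hE₀]
    congr!
  · simp only [firstFace, permWord, Function.comp_apply, Fin.tail, hE₁]
    rfl

end CubeChains

/-! ### The nerve of the category `Z(G)` of a digraph -/

section DigraphNerve

variable {V : Type u} {G : ReflDigraph V}

/-- A morphism of `Z(G)` is formal if it is one of the new arrows. -/
def IsFormal {a b : ZCat G.Vertex} (f : a ⟶ b) : Prop := f = (ZHom.z : ZHom a.vertex b.vertex)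

/-- A digraph has at most one arrow between two vertices, so formality is all that distinguishes
parallel morphisms. Equality of composable sequences is thereby reduced to objects and `FormalAt`.
-/
theorem hom_ext_isFormal {a b : ZCat G.Vertex} {f g : a ⟶ b} (h : IsFormal f ↔ IsFormal g) :
    f = g := by
  rcases f with ⟨⟨f⟩⟩ | _ <;> rcases g with ⟨⟨g⟩⟩ | _
  · rfl
  · exact h.2 rfl
  · exact (h.1 rfl).symm
  · rfl

theorem mem_range_arrow_iff {a b : ZCat G.Vertex} (f : a ⟶ b) :
    f ∈ (quiverInZ G.Vertex).arrows a b ↔ ¬ IsFormal f := by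
  rcases f with f | _
  · refine iff_of_true ⟨f, rfl⟩ ?_
    intro h
    cases h
  · refine iff_of_false ?_ (not_not.2 rfl)
    rintro ⟨g, hg⟩
    cases hg

theorem adj_of_not_isFormal {a b : ZCat G.Vertex} (f : a ⟶ b) (h : ¬ IsFormal f) :
    G.Adj a.vertex b.vertex := by
  rcases f with ⟨⟨f⟩⟩ | _
  · exact f
  · exact absurd rfl h

theorem isFormal_eqToHom_comp {a a' b b' : ZCat G.Vertex} (h : a' = a) (f : a ⟶ b) (h' : b = b') :
    IsFormal (eqToHom h ≫ f ≫ eqToHom h') ↔ IsFormal f := by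
  subst h h'
  simp

theorem isFormal_comp {a b c : ZCat G.Vertex} (f : a ⟶ b) (g : b ⟶ c) (hab : a ≠ b)
    (hbc : b ≠ c) : IsFormal (f ≫ g) := by
  refine ZHom.comp_of_not_isId ?_ ?_
  · rintro ⟨h, -⟩
    exact hab (congrArg ZCat.mk h)
  · rintro ⟨h, -⟩
    exact hbc (congrArg ZCat.mk h)

theorem not_isFormal_id (a : ZCat G.Vertex) : ¬ IsFormal (𝟙 a) := by
  intro h
  cases h

theorem isFormal_comp_iff {a b c : ZCat G.Vertex} (f : a ⟶ b) (g : b ⟶ c) (hab : a = b)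
    (hf : ¬ IsFormal f) : IsFormal (f ≫ g) ↔ IsFormal g := by
  subst hab
  have : f = 𝟙 a := hom_ext_isFormal (iff_of_false hf (not_isFormal_id a))
  rw [this, Category.id_comp]

variable {n : ℕ}

/-- The morphism from the `a`-th to the `b`-th object of a composable sequence is formal. -/
def FormalAt (F : ComposableArrows (ZCat G.Vertex) n) (a b : Fin (n + 1)) : Prop :=
  ∃ h : a ≤ b, IsFormal (F.map (homOfLE h))

theorem formalAt_iff (F : ComposableArrows (ZCat G.Vertex) n) {a b : Fin (n + 1)} (f : a ⟶ b) :
    FormalAt F a b ↔ IsFormal (F.map f) :=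
  ⟨fun ⟨_, h⟩ => h, fun h => ⟨leOfHom f, h⟩⟩

theorem formalAt_comp {F : ComposableArrows (ZCat G.Vertex) n} {a b c : Fin (n + 1)}
    (hab : a ≤ b) (hbc : b ≤ c) (h : F.obj a ≠ F.obj b) (h' : F.obj b ≠ F.obj c) :
    FormalAt F a c := by
  rw [formalAt_iff F (homOfLE hab ≫ homOfLE hbc), F.map_comp]
  exact isFormal_comp _ _ h h'

theorem formalAt_iff_of_obj_eq {F : ComposableArrows (ZCat G.Vertex) n} {a b c : Fin (n + 1)}
    (hab : a ≤ b) (hbc : b ≤ c) (h : F.obj a = F.obj b) (h' : ¬ FormalAt F a b) :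
    FormalAt F a c ↔ FormalAt F b c := by
  rw [formalAt_iff F (homOfLE hab ≫ homOfLE hbc), formalAt_iff F (homOfLE hbc), F.map_comp]
  exact isFormal_comp_iff _ _ h fun h'' => h' ⟨hab, h''⟩

theorem not_formalAt_self (F : ComposableArrows (ZCat G.Vertex) n) (a : Fin (n + 1)) :
    ¬ FormalAt F a a := by
  rw [formalAt_iff F (𝟙 a), F.map_id]
  exact not_isFormal_id _

theorem composableArrows_ext {F F' : ComposableArrows (ZCat G.Vertex) n}
    (h : ∀ i, F.obj i = F'.obj i)
    (h' : ∀ i : Fin n, FormalAt F i.castSucc i.succ ↔ FormalAt F' i.castSucc i.succ) :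
    F = F' := by
  refine ComposableArrows.ext h fun i hi => hom_ext_isFormal ?_
  rw [isFormal_eqToHom_comp]
  have := h' ⟨i, hi⟩
  rwa [formalAt_iff F (homOfLE (Fin.castSucc_lt_succ (i := ⟨i, hi⟩)).le),
    formalAt_iff F' (homOfLE (Fin.castSucc_lt_succ (i := ⟨i, hi⟩)).le)] at this

theorem mem_nerve_iff (F : ComposableArrows (ZCat G.Vertex) n) :
    F ∈ (quiverInZ G.Vertex).nerve n ↔ ∀ i : Fin n, ¬ FormalAt F i.castSucc i.succ := by
  constructor
  · rintro ⟨-, h⟩ i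
    rw [formalAt_iff F (homOfLE (Fin.castSucc_lt_succ (i := i)).le)]
    exact (mem_range_arrow_iff _).1 (h i i.2)
  · refine fun h => ⟨fun _ => Set.mem_univ _, fun i hi => (mem_range_arrow_iff _).2 ?_⟩
    have := h ⟨i, hi⟩
    rwa [formalAt_iff F (homOfLE (Fin.castSucc_lt_succ (i := ⟨i, hi⟩)).le)] at this

/-- The faces of a simplex of the nerve of a category. -/
def nerveδ {C : Type*} [Category* C] (i : Fin (n + 2)) (F : ComposableArrows C (n + 1)) :
    ComposableArrows C n := (nerve C).δ i F

/-- The degeneracies of a simplex of the nerve of a category. -/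
def nerveσ {C : Type*} [Category* C] (i : Fin (n + 1)) (F : ComposableArrows C n) :
    ComposableArrows C (n + 1) := (nerve C).σ i F

theorem nerveδ_obj {C : Type*} [Category* C] (i : Fin (n + 2)) (F : ComposableArrows C (n + 1))
    (j : Fin (n + 1)) : (nerveδ i F).obj j = F.obj (i.succAbove j) := rfl

theorem nerveσ_obj {C : Type*} [Category* C] (i : Fin (n + 1)) (F : ComposableArrows C n)
    (j : Fin (n + 2)) : (nerveσ i F).obj j = F.obj (i.predAbove j) := rfl

theorem formalAt_nerveδ (F : ComposableArrows (ZCat G.Vertex) (n + 1)) (i : Fin (n + 2))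
    {a b : Fin (n + 1)} (hab : a ≤ b) :
    FormalAt (nerveδ i F) a b ↔ FormalAt F (i.succAbove a) (i.succAbove b) :=
  ⟨fun ⟨_, h⟩ => ⟨(Fin.strictMono_succAbove i).monotone hab, h⟩, fun ⟨_, h⟩ => ⟨hab, h⟩⟩

theorem formalAt_nerveσ (F : ComposableArrows (ZCat G.Vertex) n) (i : Fin (n + 1))
    {a b : Fin (n + 2)} (hab : a ≤ b) :
    FormalAt (nerveσ i F) a b ↔ FormalAt F (i.predAbove a) (i.predAbove b) :=
  ⟨fun ⟨_, h⟩ => ⟨Fin.predAbove_right_monotone i hab, h⟩, fun ⟨_, h⟩ => ⟨hab, h⟩⟩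

/-- A composable sequence of arrows of the digraph with two equal consecutive objects is
degenerate. -/
theorem eq_nerveσ_of_obj_eq {F : ComposableArrows (ZCat G.Vertex) (n + 1)}
    (hF : F ∈ (quiverInZ G.Vertex).nerve (n + 1)) {l : Fin (n + 1)}
    (h : F.obj l.castSucc = F.obj l.succ) : F = nerveσ l (nerveδ l.succ F) := by
  have hl : l.succ.succAbove (l.predAbove l.succ) = l.castSucc := by simp
  rw [mem_nerve_iff] at hF
  refine composableArrows_ext (fun j => ?_) fun j => ?_
  · rw [nerveσ_obj, nerveδ_obj]
    by_cases hj : j = l.succ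
    · rw [hj, hl, h]
    · rw [Fin.succ_succAbove_predAbove hj]
  · rw [formalAt_nerveσ _ _ (Fin.castSucc_lt_succ (i := j)).le,
      formalAt_nerveδ _ _ (Fin.predAbove_right_monotone l (Fin.castSucc_lt_succ (i := j)).le)]
    refine iff_of_false (hF j) ?_
    by_cases hj : j = l
    · subst hj
      rw [hl, Fin.succ_succAbove_predAbove (Fin.castSucc_lt_succ (i := j)).ne]
      exact not_formalAt_self F _
    · rw [Fin.succ_succAbove_predAbove (i := j.succ) (fun h => hj (Fin.succ_injective _ h))]
      -- The arrow after the `l`-th one starts at the deleted vertex; on the right it appears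
      -- composed with the `l`-th arrow, which is an identity.
      by_cases hj' : j.castSucc = l.succ
      · have hlj : l.succ ≤ j.succ := hj' ▸ (Fin.castSucc_lt_succ (i := j)).le
        rw [hj', hl, formalAt_iff_of_obj_eq (Fin.castSucc_lt_succ (i := l)).le hlj h (hF l), ← hj']
        exact hF j
      · rw [Fin.succ_succAbove_predAbove hj']
        exact hF j

theorem nerveσ_obj_castSucc {C : Type*} [Category* C] (F : ComposableArrows C n)
    (i : Fin (n + 1)) : (nerveσ i F).obj i.castSucc = (nerveσ i F).obj i.succ := by
  rw [nerveσ_obj, nerveσ_obj, Fin.predAbove_castSucc_self, Fin.predAbove_succ_self]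

end DigraphNerve

/-! ### The simplices that remain after the removal of letters -/

section Remaining

variable {ι : Type u} {n : ℕ} {S : PreAbstractSimplicialComplex ι}

open Classical in
/-- What remains of the set of a word after the removal of the letters before the `i`-th one. -/
def remaining (w : Word ι n) (i : Fin (n + 1)) : Finset ι :=
  w.1.filter fun a => ∀ j : Fin n, j.castSucc < i → w.2 j ≠ a

theorem mem_remaining {w : Word ι n} {i : Fin (n + 1)} {a : ι} :
    a ∈ remaining w i ↔ a ∈ w.1 ∧ ∀ j : Fin n, j.castSucc < i → w.2 j ≠ a := by
  simp [remaining]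

theorem remaining_zero (w : Word ι n) : remaining w 0 = w.1 := by
  ext a
  simp [mem_remaining]

theorem remaining_firstFace (w : Word ι (n + 1)) (i : Fin (n + 1)) :
    remaining (firstFace w) i = remaining w i.succ := by
  ext a
  simp only [mem_remaining, firstFace, Finset.mem_erase, Fin.forall_fin_succ, Fin.tail]
  simp [and_assoc, and_comm, eq_comm]

theorem remaining_lastFace (w : Word ι (n + 1)) (i : Fin (n + 1)) :
    remaining (lastFace w) i = remaining w i.castSucc := by
  ext a
  simp [mem_remaining, lastFace, Fin.forall_fin_succ', Fin.init, Fin.le_last]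

theorem letter_mem_remaining_iff {w : Word ι n} (hw : IsWord S w) {l : Fin n} {i : Fin (n + 1)} :
    w.2 l ∈ remaining w i ↔ i ≤ l.castSucc := by
  rw [mem_remaining]
  constructor
  · rintro ⟨-, h⟩
    by_contra! hlt
    exact h l hlt rfl
  · refine fun h => ⟨hw.mem l, fun j hj he => ?_⟩
    rw [hw.inj he] at hj
    exact absurd hj h.not_gt

theorem exists_letter_of_notMem_remaining {w : Word ι n} {i : Fin (n + 1)} {a : ι} (ha : a ∈ w.1)
    (h : a ∉ remaining w i) : ∃ l : Fin n, l.castSucc < i ∧ w.2 l = a := by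
  rw [mem_remaining] at h
  push Not at h
  exact h ha

theorem remaining_antitone (w : Word ι n) : Antitone (remaining w) := by
  intro i j hij a ha
  rw [mem_remaining] at ha ⊢
  exact ⟨ha.1, fun l hl => ha.2 l (hl.trans_le hij)⟩

theorem remaining_ne {w : Word ι n} (hw : IsWord S w) {i j : Fin (n + 1)} (hij : i < j) :
    remaining w i ≠ remaining w j := by
  intro h
  have hi : i ≠ Fin.last n := fun h' => absurd (h' ▸ hij) (Fin.le_last j).not_gt
  obtain ⟨l, rfl⟩ := Fin.exists_castSucc_eq.2 hi
  have := (letter_mem_remaining_iff hw (l := l)).2 le_rfl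
  rw [h, letter_mem_remaining_iff hw] at this
  exact absurd hij this.not_gt

theorem remaining_succ (w : Word ι n) (i : Fin n) [DecidableEq ι] :
    remaining w i.succ = (remaining w i.castSucc).erase (w.2 i) := by
  ext a
  simp only [mem_remaining, Finset.mem_erase, Fin.castSucc_lt_succ_iff,
    Fin.castSucc_lt_castSucc_iff]
  constructor
  · rintro ⟨h₁, h₂⟩
    exact ⟨fun h => h₂ i le_rfl h.symm, h₁, fun j hj => h₂ j hj.le⟩
  · rintro ⟨h₁, h₂, h₃⟩
    refine ⟨h₂, fun j hj => ?_⟩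
    rcases hj.eq_or_lt with rfl | hj
    · exact Ne.symm h₁
    · exact h₃ j hj

theorem remaining_mem_faces {w : Word ι n} (hw : IsWord S w) (hn : n < w.1.card)
    (i : Fin (n + 1)) : remaining w i ∈ S.faces := by
  classical
  refine (S.isRelLowerSet_faces hw.face).2 (Finset.filter_subset _ _) ?_
  by_contra hne
  rw [Finset.not_nonempty_iff_eq_empty] at hne
  have : w.1 ⊆ Finset.univ.image w.2 := by
    intro a ha
    obtain ⟨l, -, rfl⟩ := exists_letter_of_notMem_remaining (i := i) ha (by rw [hne]; simp)
    exact Finset.mem_image_of_mem _ (Finset.mem_univ l)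
  have := (Finset.card_le_card this).trans Finset.card_image_le
  rw [Finset.card_univ, Fintype.card_fin] at this
  omega

/-- The letter removed at the place `l` is the only element by which two consecutive sets differ. -/
theorem letter_eq_of_remaining_eq {w w' : Word ι n} (hw : IsWord S w) (hw' : IsWord S w')
    (h₀ : w.1 = w'.1) {l : Fin n} (h₁ : remaining w l.castSucc = remaining w' l.castSucc)
    (h₂ : remaining w l.succ = remaining w' l.succ) : w.2 l = w'.2 l := by
  have h₃ := (letter_mem_remaining_iff hw (l := l)).2 le_rfl
  have h₄ : w.2 l ∉ remaining w l.succ := by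
    rw [letter_mem_remaining_iff hw]
    exact (Fin.castSucc_lt_succ (i := l)).not_ge
  rw [h₂] at h₄
  rw [h₁] at h₃
  obtain ⟨k, hk, hk'⟩ := exists_letter_of_notMem_remaining (h₀ ▸ hw.mem l) h₄
  rw [← hk', letter_mem_remaining_iff hw'] at h₃
  rw [← hk']
  refine congrArg _ ?_
  exact le_antisymm (Fin.castSucc_lt_succ_iff.1 hk) (Fin.castSucc_le_castSucc_iff.1 h₃)

theorem word_eq_of_remaining_eq {w w' : Word ι n} (hw : IsWord S w) (hw' : IsWord S w')
    (h : ∀ i, remaining w i = remaining w' i) : w = w' := by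
  have h₀ : w.1 = w'.1 := by rw [← remaining_zero w, h, remaining_zero]
  exact Prod.ext h₀ (funext fun l => letter_eq_of_remaining_eq hw hw' h₀ (h _) (h _))

/-- Between a set and the same set without two of its elements there are only two intermediate sets.
The index `i.succ.castSucc` is the stage between the removal of the letters at the places `i` and `i
+ 1`. -/
theorem word_eq_or_eq_swap {w w' : Word ι (n + 1)} (hw : IsWord S w) (hw' : IsWord S w') (i : Fin n)
    (h : ∀ j, j ≠ i.succ.castSucc → remaining w j = remaining w' j) :
    w' = w ∨ w' = permWord (Equiv.swap i.castSucc i.succ) w := by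
  have h₀ : w.1 = w'.1 := by
    rw [← remaining_zero w, h, remaining_zero]
    rw [← Fin.succ_castSucc]
    exact (Fin.succ_ne_zero _).symm
  have hl : ∀ l : Fin (n + 1), l ≠ i.castSucc → l ≠ i.succ → w'.2 l = w.2 l := by
    intro l h₁ h₂
    refine (letter_eq_of_remaining_eq hw hw' h₀ (h _ ?_) (h _ ?_)).symm
    · exact fun e => h₂ (Fin.castSucc_injective _ e)
    · rw [← Fin.succ_castSucc]
      exact fun e => h₁ (Fin.succ_injective _ e)
  have hm : ∀ l : Fin (n + 1), ∃ k, w.2 k = w'.2 l := by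
    intro l
    obtain ⟨k, -, hk⟩ := exists_letter_of_notMem_remaining (w := w) (i := Fin.last (n + 1))
      (a := w'.2 l)
      (h₀ ▸ hw'.mem l) (by
        rw [h _ (by rw [← Fin.succ_castSucc, ← Fin.succ_last, Ne, Fin.succ_inj]
                    exact (Fin.castSucc_lt_last i).ne'), letter_mem_remaining_iff hw']
        exact (Fin.castSucc_lt_last l).not_ge)
    exact ⟨k, hk⟩
  -- `g` rearranges the letters of `w` into those of `w'`; fixing all places but two, it is the
  -- identity or their transposition.
  choose g hg using hm
  have hgi : Function.Injective g := fun a b hab => hw'.inj (by rw [← hg, ← hg, hab])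
  have hgl : ∀ l : Fin (n + 1), l ≠ i.castSucc → l ≠ i.succ → g l = l := fun l h₁ h₂ =>
    hw.inj (by rw [hg, hl l h₁ h₂])
  have hne : i.castSucc ≠ i.succ := (Fin.castSucc_lt_succ (i := i)).ne
  have hgm : ∀ l, l = i.castSucc ∨ l = i.succ → g l = i.castSucc ∨ g l = i.succ := by
    intro l hl'
    by_contra! hcon
    have := hgi (hgl _ hcon.1 hcon.2)
    rw [this] at hcon
    rcases hl' with h' | h'
    · exact hcon.1 h'
    · exact hcon.2 h'
  have hww : ∀ l, w'.2 l = w.2 (g l) := fun l => (hg l).symm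
  rcases hgm i.castSucc (Or.inl rfl) with h₁ | h₁
  · have h₂ : g i.succ = i.succ := (hgm i.succ (Or.inr rfl)).resolve_left fun h₂ =>
      hne (hgi (h₁.trans h₂.symm))
    refine Or.inl (Prod.ext h₀.symm (funext fun l => ?_))
    rw [hww]
    refine congrArg _ ?_
    by_cases h₃ : l = i.castSucc
    · rw [h₃, h₁]
    by_cases h₄ : l = i.succ
    · rw [h₄, h₂]
    exact hgl l h₃ h₄
  · have h₂ : g i.succ = i.castSucc := (hgm i.succ (Or.inr rfl)).resolve_right fun h₂ =>
      hne (hgi (h₁.trans h₂.symm))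
    refine Or.inr (Prod.ext h₀.symm (funext fun l => ?_))
    rw [hww]
    simp only [permWord, Function.comp_apply]
    refine congrArg _ ?_
    by_cases h₃ : l = i.castSucc
    · rw [h₃, h₁, Equiv.swap_apply_left]
    by_cases h₄ : l = i.succ
    · rw [h₄, h₂, Equiv.swap_apply_right]
    rw [hgl l h₃ h₄, Equiv.swap_apply_of_ne_of_ne h₃ h₄]

theorem remaining_permWord_swap (w : Word ι (n + 1)) (i : Fin n) {j : Fin (n + 2)}
    (hj : j ≠ i.succ.castSucc) :
    remaining (permWord (Equiv.swap i.castSucc i.succ) w) j = remaining w j := by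
  ext a
  simp only [mem_remaining, permWord, Function.comp_apply]
  refine and_congr_right fun _ => ?_
  have key : ∀ l : Fin (n + 1), (Equiv.swap i.castSucc i.succ l).castSucc < j ↔ l.castSucc < j := by
    intro l
    have hj' : (j : ℕ) ≠ i + 1 := fun h => hj (Fin.ext (by simpa using h))
    by_cases h₁ : l = i.castSucc
    · subst h₁
      rw [Equiv.swap_apply_left, Fin.lt_def, Fin.lt_def]
      simp
      omega
    by_cases h₂ : l = i.succ
    · subst h₂
      rw [Equiv.swap_apply_right, Fin.lt_def, Fin.lt_def]
      simp
      omega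
    rw [Equiv.swap_apply_of_ne_of_ne h₁ h₂]
  constructor
  · intro h l hl
    have := h (Equiv.swap i.castSucc i.succ l) ((key l).2 hl)
    simpa using this
  · intro h l hl
    exact h _ ((key l).2 hl)

/-- A sequence of sets, each obtained from its predecessor by the removal of one element, is
described by a word. -/
theorem exists_word_of_erase [DecidableEq ι] {T : Fin (n + 1) → Finset ι} {x : Fin n → ι}
    (hT : ∀ i, T i ∈ S.faces) (hx : ∀ i, x i ∈ T i.castSucc)
    (hTx : ∀ i, T i.succ = (T i.castSucc).erase (x i)) :
    ∃ w : Word ι n, IsWord S w ∧ n < w.1.card ∧ ∀ i, remaining w i = T i := by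
  have hrem : ∀ i, remaining (T 0, x) i = T i := by
    intro i
    induction i using Fin.induction with
    | zero => exact remaining_zero _
    | succ i ih =>
      rw [hTx, ← ih]
      ext a
      simp only [mem_remaining, Finset.mem_erase, Fin.castSucc_lt_succ_iff,
    Fin.castSucc_lt_castSucc_iff]
      constructor
      · rintro ⟨h₁, h₂⟩
        exact ⟨fun h => h₂ i le_rfl h.symm, h₁, fun j hj => h₂ j hj.le⟩
      · rintro ⟨h₁, h₂, h₃⟩
        refine ⟨h₂, fun j hj => ?_⟩
        rcases hj.eq_or_lt with rfl | hj
        · exact Ne.symm h₁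
        · exact h₃ j hj
  have hlt : ∀ i j, i < j → x i ≠ x j := fun i j hij => by
    have := hx j
    rw [← hrem, mem_remaining] at this
    exact this.2 i (Fin.castSucc_lt_castSucc_iff.2 hij)
  have hcard : ∀ i : Fin (n + 1), (T i).card + i = (T 0).card := by
    intro i
    induction i using Fin.induction with
    | zero => rfl
    | succ i ih =>
      rw [← ih, hTx, ← Finset.card_erase_add_one (hx i), Fin.val_succ, Fin.val_castSucc]
      omega
  refine ⟨(T 0, x), ⟨hT 0, fun i j hij => ?_, fun i => ?_⟩, ?_, hrem⟩
  · rcases lt_trichotomy i j with h | h | h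
    · exact absurd hij (hlt i j h)
    · exact h
    · exact absurd hij.symm (hlt j i h)
  · have := hx i
    rw [← hrem, mem_remaining] at this
    exact this.1
  -- The last set is a simplex, hence non-empty, after `n` removals: this gives the strict
  -- inequality.
  · have h₁ := hcard (Fin.last n)
    have h₂ := Finset.card_pos.2 (S.isRelLowerSet_faces (hT (Fin.last n))).1
    simp only [Fin.val_last] at h₁
    change n < (T 0).card
    omega

end Remaining

/-! ### Paths in the face digraph -/

section Paths

variable {ι : Type u} {n : ℕ} {S : PreAbstractSimplicialComplex ι}

variable (S) in
/-- The category `Z(G(S))` of the digraph of a simplicial complex. -/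
abbrev FaceZ : Type u := ZCat (faceDigraph S).Vertex

/-- The simplex underlying an object of `Z(G(S))`. -/
def FaceZ.simplex (a : FaceZ S) : {σ : Finset ι // σ ∈ S.faces} := a.vertex

theorem FaceZ.ext_simplex {a b : FaceZ S} (h : a.simplex.1 = b.simplex.1) : a = b :=
  congrArg ZCat.mk (Subtype.ext h)

theorem adj_remaining {w : Word ι n} (hw : IsWord S w) (hn : n < w.1.card) (i : Fin n) :
    (faceDigraph S).Adj ⟨remaining w i.castSucc, remaining_mem_faces hw hn _⟩
      ⟨remaining w i.succ, remaining_mem_faces hw hn _⟩ := by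
  classical
  refine Or.inr ⟨remaining_antitone w (Fin.castSucc_lt_succ (i := i)).le, ?_⟩
  simp only [remaining_succ]
  exact (Finset.card_erase_add_one ((letter_mem_remaining_iff hw).2 le_rfl)).symm

/-- The path in the digraph of a simplicial complex along which the letters of a word are
removed. -/
def wordPath (w : Word ι n) (hw : IsWord S w) (hn : n < w.1.card) :
    ComposableArrows (FaceZ S) n :=
  ComposableArrows.mkOfObjOfMapSucc
    (fun i => (⟨⟨remaining w i, remaining_mem_faces hw hn i⟩⟩ : FaceZ S))
    (fun i => (ZHom.arrow ⟨adj_remaining hw hn i⟩ : ZHom (V := (faceDigraph S).Vertex) _ _))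

theorem wordPath_obj (w : Word ι n) (hw : IsWord S w) (hn : n < w.1.card) (i : Fin (n + 1)) :
    ((wordPath w hw hn).obj i).simplex.1 = remaining w i := by
  rw [wordPath, ComposableArrows.mkOfObjOfMapSucc_obj]
  rfl

theorem wordPath_mem_nerve (w : Word ι n) (hw : IsWord S w) (hn : n < w.1.card) :
    wordPath w hw hn ∈ (quiverInZ (faceDigraph S).Vertex).nerve n := by
  refine ⟨fun _ => Set.mem_univ _, fun i hi => ?_⟩
  rw [wordPath, ComposableArrows.mkOfObjOfMapSucc_map_succ _ _ i hi]
  exact ⟨_, rfl⟩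

theorem wordPath_obj_ne (w : Word ι n) (hw : IsWord S w) (hn : n < w.1.card) {i j : Fin (n + 1)}
    (hij : i < j) : (wordPath w hw hn).obj i ≠ (wordPath w hw hn).obj j := by
  intro h
  have := congrArg (fun a : FaceZ S => a.simplex.1) h
  simp only [wordPath_obj] at this
  exact remaining_ne hw hij this

theorem wordPath_injective {w w' : Word ι n} (hw : IsWord S w) (hn : n < w.1.card)
    (hw' : IsWord S w') (hn' : n < w'.1.card) (h : wordPath w hw hn = wordPath w' hw' hn') :
    w = w' := by
  refine word_eq_of_remaining_eq hw hw' fun i => ?_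
  rw [← wordPath_obj w hw hn, h, wordPath_obj]

theorem not_formalAt_wordPath (w : Word ι n) (hw : IsWord S w) (hn : n < w.1.card) (i : Fin n) :
    ¬ FormalAt (wordPath w hw hn) i.castSucc i.succ :=
  (mem_nerve_iff _).1 (wordPath_mem_nerve w hw hn) i

theorem lt_card_firstFace {w : Word ι (n + 1)} (hw : IsWord S w) (hn : n + 1 < w.1.card) :
    n < (firstFace w).1.card := by
  have := card_firstFace hw
  omega

theorem nerveδ_zero_wordPath (w : Word ι (n + 1)) (hw : IsWord S w) (hn : n + 1 < w.1.card) :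
    nerveδ 0 (wordPath w hw hn) =
      wordPath (firstFace w) (hw.firstFace (by omega)) (lt_card_firstFace hw hn) := by
  refine composableArrows_ext (fun i => FaceZ.ext_simplex ?_) fun i => ?_
  · rw [nerveδ_obj, wordPath_obj, wordPath_obj, Fin.zero_succAbove, remaining_firstFace]
  · refine iff_of_false ?_ (not_formalAt_wordPath _ _ _ i)
    rw [formalAt_nerveδ _ _ (Fin.castSucc_lt_succ (i := i)).le, Fin.zero_succAbove,
      Fin.zero_succAbove, Fin.succ_castSucc]
    exact not_formalAt_wordPath w hw hn i.succ

theorem nerveδ_last_wordPath (w : Word ι (n + 1)) (hw : IsWord S w) (hn : n + 1 < w.1.card) :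
    nerveδ (Fin.last (n + 1)) (wordPath w hw hn) =
      wordPath (lastFace w) hw.lastFace (Nat.lt_of_succ_lt hn) := by
  refine composableArrows_ext (fun i => FaceZ.ext_simplex ?_) fun i => ?_
  · rw [nerveδ_obj, wordPath_obj, wordPath_obj, Fin.succAbove_last, remaining_lastFace]
  · refine iff_of_false ?_ (not_formalAt_wordPath _ _ _ i)
    rw [formalAt_nerveδ _ _ (Fin.castSucc_lt_succ (i := i)).le, Fin.succAbove_last,
      ← Fin.succ_castSucc]
    exact not_formalAt_wordPath w hw hn i.castSucc

/-- Deleting an inner vertex composes two non-identity arrows, which gives a formal arrow, and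
leaves all others alone. The position of the formal arrow therefore records which vertex was
deleted. -/
theorem formalAt_nerveδ_wordPath (w : Word ι (n + 1)) (hw : IsWord S w) (hn : n + 1 < w.1.card)
    (i l : Fin n) : FormalAt (nerveδ i.succ.castSucc (wordPath w hw hn)) l.castSucc l.succ ↔
      l = i := by
  rw [formalAt_nerveδ _ _ (Fin.castSucc_lt_succ (i := l)).le]
  have hval : ∀ m : Fin (n + 1), ((i.succ.castSucc.succAbove m : Fin (n + 2)) : ℕ) =
      if (m : ℕ) < i + 1 then (m : ℕ) else m + 1 := by
    intro m
    simp only [Fin.succAbove, Fin.lt_def, Fin.val_castSucc, Fin.val_succ]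
    split_ifs <;> simp
  rcases lt_trichotomy l i with h | rfl | h
  · refine iff_of_false ?_ h.ne
    have h₁ : i.succ.castSucc.succAbove l.castSucc = l.castSucc.castSucc := by
      refine Fin.ext ?_
      rw [hval, Fin.val_castSucc, if_pos (by simp only [Fin.lt_def] at h; omega)]
      simp
    have h₂ : i.succ.castSucc.succAbove l.succ = l.castSucc.succ := by
      refine Fin.ext ?_
      rw [hval, Fin.val_succ, if_pos (by simp only [Fin.lt_def] at h; omega)]
      simp
    rw [h₁, h₂]
    exact not_formalAt_wordPath w hw hn l.castSucc
  · refine iff_of_true ?_ rfl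
    have h₁ : l.succ.castSucc.succAbove l.castSucc = l.castSucc.castSucc := by
      refine Fin.ext ?_
      rw [hval, Fin.val_castSucc, if_pos (by omega)]
      simp
    have h₂ : l.succ.castSucc.succAbove l.succ = l.succ.succ := by
      refine Fin.ext ?_
      rw [hval, Fin.val_succ, if_neg (by omega)]
      simp
    rw [h₁, h₂]
    have h₃ : l.castSucc.castSucc < l.succ.castSucc :=
      Fin.castSucc_lt_castSucc_iff.2 (Fin.castSucc_lt_succ (i := l))
    have h₄ : l.succ.castSucc < l.succ.succ := Fin.castSucc_lt_succ (i := l.succ)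
    exact formalAt_comp h₃.le h₄.le (wordPath_obj_ne w hw hn h₃) (wordPath_obj_ne w hw hn h₄)
  · refine iff_of_false ?_ h.ne'
    have h₁ : i.succ.castSucc.succAbove l.castSucc = l.succ.castSucc := by
      refine Fin.ext ?_
      rw [hval, Fin.val_castSucc, if_neg (by simp only [Fin.lt_def] at h; omega)]
      simp
    have h₂ : i.succ.castSucc.succAbove l.succ = l.succ.succ := by
      refine Fin.ext ?_
      rw [hval, Fin.val_succ, if_neg (by simp only [Fin.lt_def] at h; omega)]
      simp
    rw [h₁, h₂]
    exact not_formalAt_wordPath w hw hn l.succ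

theorem nerveδ_wordPath_obj_ne (w : Word ι (n + 1)) (hw : IsWord S w) (hn : n + 1 < w.1.card)
    (k : Fin (n + 2)) (l : Fin n) : (nerveδ k (wordPath w hw hn)).obj l.castSucc ≠
      (nerveδ k (wordPath w hw hn)).obj l.succ := by
  rw [nerveδ_obj, nerveδ_obj]
  exact wordPath_obj_ne w hw hn (Fin.strictMono_succAbove k (Fin.castSucc_lt_succ (i := l)))

theorem nerveδ_wordPath_swap (w : Word ι (n + 1)) (hw : IsWord S w) (hn : n + 1 < w.1.card)
    (i : Fin n) (hn' : n + 1 < (permWord (Equiv.swap i.castSucc i.succ) w).1.card) :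
    nerveδ i.succ.castSucc
        (wordPath (permWord (Equiv.swap i.castSucc i.succ) w) (hw.perm _) hn') =
      nerveδ i.succ.castSucc (wordPath w hw hn) := by
  refine composableArrows_ext (fun j => FaceZ.ext_simplex ?_) fun l => ?_
  · rw [nerveδ_obj, nerveδ_obj, wordPath_obj, wordPath_obj,
      remaining_permWord_swap w i (Fin.succAbove_ne _ _)]
  · rw [formalAt_nerveδ_wordPath, formalAt_nerveδ_wordPath]

theorem eq_or_eq_swap_of_nerveδ_wordPath_eq {w w' : Word ι (n + 1)} (hw : IsWord S w)
    (hn : n + 1 < w.1.card) (hw' : IsWord S w') (hn' : n + 1 < w'.1.card) (i : Fin n)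
    (h : nerveδ i.succ.castSucc (wordPath w' hw' hn') =
      nerveδ i.succ.castSucc (wordPath w hw hn)) :
    w' = w ∨ w' = permWord (Equiv.swap i.castSucc i.succ) w := by
  refine word_eq_or_eq_swap hw hw' i fun j hj => ?_
  obtain ⟨l, rfl⟩ := Fin.exists_succAbove_eq hj
  have := congrArg (fun F : ComposableArrows (FaceZ S) n => (F.obj l).simplex.1) h
  simp only [nerveδ_obj, wordPath_obj] at this
  exact this.symm

/-- A composable sequence of arrows of the digraph is degenerate, or the path of a word. -/
theorem exists_obj_eq_or_exists_wordPath {F : ComposableArrows (FaceZ S) n}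
    (hF : F ∈ (quiverInZ (faceDigraph S).Vertex).nerve n) :
    (∃ l : Fin n, F.obj l.castSucc = F.obj l.succ) ∨
      ∃ (w : Word ι n) (hw : IsWord S w) (hn : n < w.1.card), F = wordPath w hw hn := by
  classical
  by_cases h : ∃ l : Fin n, F.obj l.castSucc = F.obj l.succ
  · exact Or.inl h
  refine Or.inr ?_
  push Not at h
  rw [mem_nerve_iff] at hF
  have hadj : ∀ l : Fin n, ∃ a ∈ (F.obj l.castSucc).simplex.1,
      (F.obj l.succ).simplex.1 = (F.obj l.castSucc).simplex.1.erase a := by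
    intro l
    have h₁ := hF l
    rw [formalAt_iff F (homOfLE (Fin.castSucc_lt_succ (i := l)).le)] at h₁
    rcases adj_of_not_isFormal _ h₁ with h₂ | ⟨h₂, h₃⟩
    · exact absurd (congrArg ZCat.mk h₂) (h l)
    · obtain ⟨a, ha⟩ := Finset.exists_eq_insert_iff.2 ⟨h₂, h₃.symm⟩
      obtain ⟨ha, ha'⟩ := ha
      refine ⟨a, ?_, ?_⟩
      · change a ∈ (F.obj l.castSucc).vertex.1
        rw [← ha']
        exact Finset.mem_insert_self _ _
      · change (F.obj l.succ).vertex.1 = (F.obj l.castSucc).vertex.1.erase a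
        rw [← ha', Finset.erase_insert ha]
  choose x hx hx' using hadj
  obtain ⟨w, hw, hn, hwr⟩ := exists_word_of_erase (S := S) (T := fun i => (F.obj i).simplex.1)
    (fun i => (F.obj i).simplex.2) hx hx'
  refine ⟨w, hw, hn, composableArrows_ext (fun i => FaceZ.ext_simplex ?_) fun i =>
    iff_of_false (hF i) (not_formalAt_wordPath w hw hn i)⟩
  rw [wordPath_obj, hwr]

end Paths

/-! ### Coefficients of chains -/

section Coefficients

variable {K : Type w} [CommRing K] {X : SSet.{u}} {n : ℕ}

variable (K) in
/-- The coefficient of a simplex in a chain. -/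
def chainCoeff (s : X _⦋n⦌) : (freeSimplicialModule K X) _⦋n⦌ →ₗ[K] K :=
  (Finsupp.lapply s : (X _⦋n⦌ →₀ K) →ₗ[K] K)

open Classical in
theorem chainCoeff_basisElement (s t : X _⦋n⦌) :
    chainCoeff K s (basisElement K t) = if t = s then 1 else 0 :=
  Finsupp.single_apply

theorem chainCoeff_eq_zero_of_mem_supported {A : Set (X _⦋n⦌)} {s : X _⦋n⦌} (hs : s ∉ A)
    {x : (freeSimplicialModule K X) _⦋n⦌} (hx : x ∈ Finsupp.supported K K A) :
    chainCoeff K s x = 0 := by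
  by_contra h
  exact hs (hx (Finsupp.mem_support_iff.2 h))

theorem σ_basisElement (i : Fin (n + 1)) (x : X _⦋n⦌) :
    ((freeSimplicialModule K X).σ i).hom (basisElement K x) = basisElement K (X.σ i x) :=
  Finsupp.mapDomain_single

theorem span_basisElement :
    Submodule.span K (Set.range (basisElement K : X _⦋n⦌ → (freeSimplicialModule K X) _⦋n⦌)) =
      ⊤ := by
  rw [eq_top_iff]
  rintro (x : X _⦋n⦌ →₀ K) -
  induction x using Finsupp.induction_linear with
  | zero => exact zero_mem _
  | add f g hf hg => exact add_mem hf hg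
  | single a b =>
    have : (Finsupp.single a b : X _⦋n⦌ →₀ K) = b • (Finsupp.single a 1 : X _⦋n⦌ →₀ K) := by
      rw [Finsupp.smul_single, smul_eq_mul, mul_one]
    rw [this]
    exact Submodule.smul_mem _ b (Submodule.subset_span ⟨a, rfl⟩)

theorem hom_ext_basisElement {M : Type*} [AddCommGroup M] [Module K M]
    {f g : (freeSimplicialModule K X) _⦋n⦌ →ₗ[K] M}
    (h : ∀ s, f (basisElement K s) = g (basisElement K s)) : f = g :=
  LinearMap.ext_on_range (v := (basisElement K : X _⦋n⦌ → (freeSimplicialModule K X) _⦋n⦌))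
    span_basisElement h

theorem chainCoeff_eq_zero_of_mem_degenerate {s : X _⦋n + 1⦌}
    (hs : ∀ (i : Fin (n + 1)) (t : X _⦋n⦌), X.σ i t ≠ s)
    {x : (freeSimplicialModule K X) _⦋n + 1⦌}
    (hx : x ∈ degenerateSubmodule (freeSimplicialModule K X) (n + 1)) : chainCoeff K s x = 0 := by
  have : degenerateSubmodule (freeSimplicialModule K X) (n + 1) ≤
      LinearMap.ker (chainCoeff K s) := by
    refine iSup_le fun i => ?_
    rintro _ ⟨y, rfl⟩
    have h : (chainCoeff K s).comp ((freeSimplicialModule K X).σ i).hom = 0 := by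
      classical
      refine hom_ext_basisElement fun t => ?_
      rw [LinearMap.comp_apply, σ_basisElement, chainCoeff_basisElement, if_neg (hs i t),
        LinearMap.zero_apply]
    exact congrArg (fun f => f y) h
  exact this hx

end Coefficients

/-! ### Words and square-commutative chains -/

section PathChains

variable {ι : Type u} {S : PreAbstractSimplicialComplex ι} {K : Type w} [CommRing K] {n : ℕ}

variable (S K) in
/-- The simplicial module of the nerve of `Z(G(S))`. -/
abbrev faceModule : SimplicialObject (ModuleCat.{max u w} K) :=
  freeSimplicialModule K (nerve (FaceZ S))

variable (S) in
/-- The simplices of the nerve of `Z(G(S))` that are sequences of arrows of the digraph. -/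
def pathSet (n : ℕ) : Set (nerve (FaceZ S) _⦋n⦌) := (quiverInZ (faceDigraph S).Vertex).nerve n

variable (S K) in
/-- The chains spanned by the sequences of arrows of the digraph. -/
def arrowChains (n : ℕ) : Submodule K ((faceModule S K) _⦋n⦌) :=
  Finsupp.supported K K (pathSet S n)

variable (S K) in
/-- The boundary map of the chain complex of the nerve of `Z(G(S))`. -/
def faceBoundary (n : ℕ) : (faceModule S K) _⦋n + 1⦌ →ₗ[K] (faceModule S K) _⦋n⦌ :=
  ((chains (faceModule S K)).d (n + 1) n).hom

/-- A simplex of the nerve, as an element of the simplicial module. -/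
def pathElement (K : Type w) [CommRing K] (F : ComposableArrows (FaceZ S) n) :
    (faceModule S K) _⦋n⦌ :=
  basisElement K (X := nerve (FaceZ S)) (n := n) F

theorem δ_pathElement (i : Fin (n + 2)) F :
    ((faceModule S K).δ i).hom (pathElement K F) = pathElement K (nerveδ i F) :=
  δ_basisElement K i (X := nerve (FaceZ S)) F

theorem σ_pathElement (i : Fin (n + 1)) (F : ComposableArrows (FaceZ S) n) :
    ((faceModule S K).σ i).hom (pathElement K F) = pathElement K (nerveσ i F) :=
  σ_basisElement i (X := nerve (FaceZ S)) F

/-- The coefficient of a composable sequence. -/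
def pathCoeff (K : Type w) [CommRing K] (F : ComposableArrows (FaceZ S) n) :
    (faceModule S K) _⦋n⦌ →ₗ[K] K :=
  chainCoeff K (X := nerve (FaceZ S)) (n := n) F

open Classical in
theorem pathCoeff_pathElement (F F' : ComposableArrows (FaceZ S) n) :
    pathCoeff K F (pathElement K F') = if F' = F then 1 else 0 :=
  chainCoeff_basisElement (X := nerve (FaceZ S)) (n := n) F F'

/-- A degeneracy repeats an object. So the coefficient of a sequence without consecutive repetitions
is well defined on normalized chains. -/
theorem pathCoeff_eq_zero_of_mem_degenerate {F : ComposableArrows (FaceZ S) n}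
    (hF : ∀ l : Fin n, F.obj l.castSucc ≠ F.obj l.succ) {x : (faceModule S K) _⦋n⦌}
    (hx : x ∈ degenerateSubmodule (faceModule S K) n) : pathCoeff K F x = 0 := by
  cases n with
  | zero =>
    rw [show x = 0 from hx, map_zero]
  | succ n =>
    refine chainCoeff_eq_zero_of_mem_degenerate (X := nerve (FaceZ S)) (fun i t h => hF i ?_) hx
    have h' : nerveσ i (t : ComposableArrows (FaceZ S) n) = F := h
    rw [← h']
    exact nerveσ_obj_castSucc _ i

theorem pathCoeff_eq_zero_of_mem_arrowChains {F : ComposableArrows (FaceZ S) n}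
    (hF : F ∉ (quiverInZ (faceDigraph S).Vertex).nerve n) {x : (faceModule S K) _⦋n⦌}
    (hx : x ∈ arrowChains S K n) : pathCoeff K F x = 0 :=
  chainCoeff_eq_zero_of_mem_supported (X := nerve (FaceZ S)) (n := n) hF hx

variable (S) in
open Classical in
/-- The chain of paths described by a linear combination of words. -/
def pathChain (K : Type w) [CommRing K] (n : ℕ) :
    (Word ι n →₀ K) →ₗ[K] (faceModule S K) _⦋n⦌ :=
  Finsupp.linearCombination K fun w =>
    if h : IsWord S w ∧ n < w.1.card then pathElement K (wordPath w h.1 h.2) else 0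

theorem pathChain_single {w : Word ι n} (hw : IsWord S w) (hn : n < w.1.card) :
    pathChain S K n (Finsupp.single w 1) = pathElement K (wordPath w hw hn) := by
  rw [pathChain, Finsupp.linearCombination_single, one_smul, dif_pos ⟨hw, hn⟩]

variable (S K n) in
/-- The linear combinations of admissible words that do not exhaust their simplex. -/
def wordChains : Submodule K (Word ι n →₀ K) :=
  Finsupp.supported K K {w | IsWord S w ∧ n < w.1.card}

theorem mem_wordChains {c : Word ι n →₀ K} :
    c ∈ wordChains S K n ↔ ∀ w, c w ≠ 0 → IsWord S w ∧ n < w.1.card := by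
  simp only [wordChains, Finsupp.mem_supported, Set.subset_def,
    Finset.mem_coe, Finsupp.mem_support_iff, Set.mem_ofPred_eq]

theorem wordChains_of_cubeChains {c : Word ι n →₀ K} (hc : c ∈ cubeChains S K n) :
    c ∈ wordChains S K n := by
  rw [mem_cubeChains] at hc
  exact mem_wordChains.2 fun w hw => ⟨hc.1.1 w hw, hc.2 w hw⟩

/-- A linear map on `pathChain` of a linear combination of admissible words. -/
theorem map_pathChain {M : Type*} [AddCommGroup M] [Module K M]
    (f : (faceModule S K) _⦋n⦌ →ₗ[K] M) {g : Word ι n → M}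
    {c : Word ι n →₀ K} (hc : c ∈ wordChains S K n)
    (hg : ∀ w (hw : IsWord S w) (hn : n < w.1.card), f (pathElement K (wordPath w hw hn)) = g w) :
    f (pathChain S K n c) = Finsupp.linearCombination K g c := by
  rw [pathChain, Finsupp.apply_linearCombination, Finsupp.linearCombination_apply,
    Finsupp.linearCombination_apply]
  refine Finsupp.sum_congr fun w hw => ?_
  have h := mem_wordChains.1 hc w (Finsupp.mem_support_iff.1 hw)
  rw [Function.comp_apply, dif_pos h, hg w h.1 h.2]

theorem pathChain_mem_arrowChains {c : Word ι n →₀ K} (hc : c ∈ wordChains S K n) :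
    pathChain S K n c ∈ arrowChains S K n := by
  rw [pathChain, Finsupp.linearCombination_apply, Finsupp.sum]
  refine Submodule.sum_mem _ fun w hw => Submodule.smul_mem _ _ ?_
  have h := mem_wordChains.1 hc w (Finsupp.mem_support_iff.1 hw)
  rw [dif_pos h]
  exact Finsupp.single_mem_supported K 1 (wordPath_mem_nerve w h.1 h.2)

theorem pathCoeff_pathChain {c : Word ι n →₀ K} (hc : c ∈ wordChains S K n) {w : Word ι n}
    (hw : IsWord S w) (hn : n < w.1.card) :
    pathCoeff K (wordPath w hw hn) (pathChain S K n c) = c w := by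
  classical
  rw [map_pathChain (g := fun w' => if w' = w then 1 else 0) _ hc, Finsupp.linearCombination_apply,
    Finsupp.sum, Finset.sum_eq_single w]
  · simp
  · intro w' _ hne
    simp [hne]
  · intro h
    simp [Finsupp.notMem_support_iff.1 h]
  · intro w' hw' hn'
    rw [pathCoeff_pathElement]
    refine if_congr ⟨fun h => wordPath_injective hw' hn' hw hn h, ?_⟩ rfl rfl
    rintro rfl
    rfl

/-- Distinct words give distinct non-degenerate paths, so the coefficients of `c` can be read off
modulo degenerate chains. -/
theorem eq_zero_of_pathChain_mem_degenerate {c : Word ι n →₀ K} (hc : c ∈ wordChains S K n)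
    (h : pathChain S K n c ∈ degenerateSubmodule (faceModule S K) n) : c = 0 := by
  ext w
  by_contra hne
  obtain ⟨hw, hn⟩ := mem_wordChains.1 hc w hne
  refine hne ?_
  rw [← pathCoeff_pathChain hc hw hn]
  exact pathCoeff_eq_zero_of_mem_degenerate
    (fun l => wordPath_obj_ne w hw hn (Fin.castSucc_lt_succ (i := l))) h

/-- Chains of arrows of the digraph are described by words, modulo degenerate chains. -/
theorem arrowChains_le : arrowChains S K n ≤
    (wordChains S K n).map (pathChain S K n) ⊔ degenerateSubmodule (faceModule S K) n := by
  have hspan : arrowChains S K n ≤ Submodule.span K (pathElement K ''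
      (quiverInZ (faceDigraph S).Vertex).nerve n) :=
    le_of_eq (Finsupp.supported_eq_span_single K (pathSet S n))
  refine hspan.trans (Submodule.span_le.2 ?_)
  rintro _ ⟨F, hF, rfl⟩
  rw [SetLike.mem_coe]
  rcases exists_obj_eq_or_exists_wordPath hF with ⟨l, hl⟩ | ⟨w, hw, hn, h⟩
  · refine Submodule.mem_sup_right ?_
    cases n with
    | zero => exact l.elim0
    | succ n =>
      rw [eq_nerveσ_of_obj_eq hF hl]
      have := σ_mem_degenerateSubmodule (faceModule S K) n l
        (pathElement K (nerveδ l.succ F))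
      rwa [σ_pathElement] at this
  · refine Submodule.mem_sup_left ⟨Finsupp.single w 1, ?_, ?_⟩
    · exact Finsupp.single_mem_supported K 1 ⟨hw, hn⟩
    · rw [pathChain_single hw hn, h]

/-! ### Faces and boundaries of chains of paths -/

theorem δ_pathChain_zero {c : Word ι (n + 1) →₀ K} (hc : c ∈ wordChains S K (n + 1)) :
    ((faceModule S K).δ 0).hom (pathChain S K (n + 1) c) =
      pathChain S K n (Finsupp.mapDomain firstFace c) := by
  rw [map_pathChain (g := fun w => pathChain S K n (Finsupp.single (firstFace w) 1)) _ hc]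
  · rw [Finsupp.linearCombination_apply, Finsupp.mapDomain, map_finsuppSum]
    refine Finsupp.sum_congr fun w _ => ?_
    rw [← map_smul, Finsupp.smul_single, smul_eq_mul, mul_one]
  · intro w hw hn
    rw [δ_pathElement, nerveδ_zero_wordPath, pathChain_single]

theorem δ_pathChain_last {c : Word ι (n + 1) →₀ K} (hc : c ∈ wordChains S K (n + 1)) :
    ((faceModule S K).δ (Fin.last (n + 1))).hom (pathChain S K (n + 1) c) =
      pathChain S K n (Finsupp.mapDomain lastFace c) := by
  rw [map_pathChain (g := fun w => pathChain S K n (Finsupp.single (lastFace w) 1)) _ hc]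
  · rw [Finsupp.linearCombination_apply, Finsupp.mapDomain, map_finsuppSum]
    refine Finsupp.sum_congr fun w _ => ?_
    rw [← map_smul, Finsupp.smul_single, smul_eq_mul, mul_one]
  · intro w hw hn
    rw [δ_pathElement, nerveδ_last_wordPath, pathChain_single]

/-- The face forgets the order of the letters at the places `i` and `i + 1`, so the two orders
cancel. -/
theorem δ_pathChain_inner {c : Word ι (n + 1) →₀ K} (hc : c ∈ cubeChains S K (n + 1)) (i : Fin n) :
    ((faceModule S K).δ i.succ.castSucc).hom (pathChain S K (n + 1) c) = 0 := by
  classical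
  have hne : i.castSucc ≠ i.succ := (Fin.castSucc_lt_succ (i := i)).ne
  rw [map_pathChain (g := fun w => if h : IsWord S w ∧ n + 1 < w.1.card then
    pathElement K (nerveδ i.succ.castSucc (wordPath w h.1 h.2)) else 0) _
    (wordChains_of_cubeChains hc)]
  · rw [mem_cubeChains] at hc
    refine linearCombination_eq_zero_of_involution c _
      (permWord (Equiv.swap i.castSucc i.succ)) (permWord_swap_swap _ _)
      (altChains_swap hc.1 hne) (fun w hw => permWord_swap_ne (hc.1.1 w hw).inj hne)
      fun w hw => ?_
    have h₁ := hc.1.1 w hw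
    have h₂ := hc.2 w hw
    have h₃ : n + 1 < (permWord (Equiv.swap i.castSucc i.succ) w).1.card := h₂
    rw [dif_pos ⟨h₁.perm _, h₃⟩, dif_pos ⟨h₁, h₂⟩, nerveδ_wordPath_swap w h₁ h₂ i h₃]
  · intro w hw hn
    rw [dif_pos ⟨hw, hn⟩, δ_pathElement]

theorem d_pathChain {c : Word ι (n + 1) →₀ K} (hc : c ∈ cubeChains S K (n + 1)) :
    faceBoundary S K n (pathChain S K (n + 1) c) =
      pathChain S K n (wordBoundary n c) := by
  rw [faceBoundary, chains_d_apply, Fin.sum_univ_succ, Fin.sum_univ_castSucc, Finset.sum_eq_zero]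
  · rw [δ_pathChain_zero (wordChains_of_cubeChains hc), Fin.succ_last,
      δ_pathChain_last (wordChains_of_cubeChains hc), wordBoundary_apply, map_add, map_zsmul]
    simp
  · intro i _
    rw [Fin.succ_castSucc, δ_pathChain_inner hc, smul_zero]

/-- If the boundary of a chain of paths consists of paths, modulo degenerate chains, then the
chain is alternating. -/
theorem mem_cubeChains_of_d_mem {c : Word ι (n + 1) →₀ K} (hc : c ∈ wordChains S K (n + 1))
    (h : faceBoundary S K n (pathChain S K (n + 1) c) ∈
      arrowChains S K n ⊔ degenerateSubmodule (faceModule S K) n) :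
    c ∈ cubeChains S K (n + 1) := by
  classical
  have hcw := mem_wordChains.1 hc
  refine mem_cubeChains.2 ⟨mem_altChains_of_swap (fun w hw => (hcw w hw).1) fun w i => ?_,
    fun w hw => (hcw w hw).2⟩
  have hne : i.castSucc ≠ i.succ := (Fin.castSucc_lt_succ (i := i)).ne
  by_cases hw : IsWord S w ∧ n + 1 < w.1.card
  swap
  · have h₁ : c w = 0 := by
      by_contra h'
      exact hw (hcw w h')
    have h₂ : c (permWord (Equiv.swap i.castSucc i.succ) w) = 0 := by
      by_contra h'
      obtain ⟨h₃, h₄⟩ := hcw _ h'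
      have := h₃.perm (Equiv.swap i.castSucc i.succ)
      rw [permWord_swap_swap] at this
      exact hw ⟨this, h₄⟩
    rw [h₁, h₂, neg_zero]
  obtain ⟨hw, hn⟩ := hw
  have hn' : n + 1 < (permWord (Equiv.swap i.castSucc i.succ) w).1.card := hn
  -- `s` contains a formal arrow but no consecutive repetition, so its coefficient vanishes on
  -- chains of arrows and on degenerate chains alike. Comparing coefficients of `s` in the boundary
  -- gives the sign rule.
  set s := nerveδ i.succ.castSucc (wordPath w hw hn) with hs
  have hsF : s ∉ (quiverInZ (faceDigraph S).Vertex).nerve n := by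
    rw [mem_nerve_iff]
    exact fun h => h i ((formalAt_nerveδ_wordPath w hw hn i i).2 rfl)
  have hs₀ : pathCoeff K s (faceBoundary S K n
      (pathChain S K (n + 1) c)) = 0 := by
    obtain ⟨a, ha, b, hb, hab⟩ := Submodule.mem_sup.1 h
    rw [← hab, map_add, pathCoeff_eq_zero_of_mem_arrowChains hsF ha,
      pathCoeff_eq_zero_of_mem_degenerate (nerveδ_wordPath_obj_ne w hw hn _) hb, add_zero]
  -- Any other face of a path has its formal arrow at another position, or none at all, and so never
  -- equals `s`.
  have hδ : ∀ k : Fin (n + 2), k ≠ i.succ.castSucc →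
      pathCoeff K s (((faceModule S K).δ k).hom (pathChain S K (n + 1) c)) = 0 := by
    intro k hk
    rw [← LinearMap.comp_apply, map_pathChain (g := fun _ => (0 : K)) _ hc]
    · simp [Finsupp.linearCombination_apply]
    · intro w' hw' hn'
      rw [LinearMap.comp_apply, δ_pathElement, pathCoeff_pathElement, if_neg]
      intro he
      have hz : FormalAt (nerveδ k (wordPath w' hw' hn')) i.castSucc i.succ := by
        rw [he]
        exact (formalAt_nerveδ_wordPath w hw hn i i).2 rfl
      have hQ : ∀ F ∈ (quiverInZ (faceDigraph S).Vertex).nerve n,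
          ¬ FormalAt F i.castSucc i.succ := fun F hF => (mem_nerve_iff F).1 hF i
      rcases Fin.eq_zero_or_eq_succ k with rfl | ⟨k, rfl⟩
      · rw [nerveδ_zero_wordPath] at hz
        exact hQ _ (wordPath_mem_nerve _ _ _) hz
      · rcases Fin.eq_castSucc_or_eq_last k with ⟨k, rfl⟩ | rfl
        · rw [Fin.succ_castSucc, formalAt_nerveδ_wordPath] at hz
          rw [← hz, Fin.succ_castSucc] at hk
          exact hk rfl
        · rw [Fin.succ_last, nerveδ_last_wordPath] at hz
          exact hQ _ (wordPath_mem_nerve _ _ _) hz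
  rw [faceBoundary, chains_d_apply, map_sum, Finset.sum_eq_single i.succ.castSucc] at hs₀
  rotate_left
  · intro k _ hk
    rw [map_zsmul, hδ k hk, smul_zero]
  · exact fun h => absurd (Finset.mem_univ _) h
  -- Exactly two paths have `s` as this face: those of `w` and of its transposed word.
  have hsum : pathCoeff K s (((faceModule S K).δ i.succ.castSucc).hom (pathChain S K (n + 1) c)) =
      c w + c (permWord (Equiv.swap i.castSucc i.succ) w) := by
    have hww := permWord_swap_ne hw.inj hne
    rw [← LinearMap.comp_apply, map_pathChain (g := fun w' =>
      (if w' = w then (1 : K) else 0) +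
        if w' = permWord (Equiv.swap i.castSucc i.succ) w then (1 : K) else 0) _ hc]
    · rw [Finsupp.linearCombination_apply]
      simp only [smul_eq_mul, mul_add, mul_ite, mul_one, mul_zero]
      rw [Finsupp.sum_add, Finsupp.sum_ite_eq', Finsupp.sum_ite_eq']
      congr 1 <;>
      · split_ifs with h'
        · rfl
        · exact (Finsupp.notMem_support_iff.1 h').symm
    · intro w' hw' hn''
      rw [LinearMap.comp_apply, δ_pathElement, pathCoeff_pathElement]
      by_cases h₁ : w' = w
      · subst h₁
        rw [if_pos rfl, if_pos rfl, if_neg hww.symm, add_zero]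
      by_cases h₂ : w' = permWord (Equiv.swap i.castSucc i.succ) w
      · subst h₂
        rw [nerveδ_wordPath_swap w hw hn i hn'', if_pos rfl, if_neg hww, if_pos rfl, zero_add]
      · rw [if_neg, if_neg h₁, if_neg h₂, add_zero]
        intro he
        rcases eq_or_eq_swap_of_nerveδ_wordPath_eq hw hn hw' hn'' i he with h₃ | h₃
        · exact h₁ h₃
        · exact h₂ h₃
  rw [map_zsmul, hsum] at hs₀
  have : c w + c (permWord (Equiv.swap i.castSucc i.succ) w) = 0 := by
    rcases neg_one_pow_eq_or ℤ (i.succ.castSucc : ℕ) with h | h <;> rw [h] at hs₀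
    · rwa [one_smul] at hs₀
    · rwa [neg_smul, one_smul, neg_eq_zero] at hs₀
  rw [eq_neg_iff_add_eq_zero, add_comm]
  exact this

end PathChains

/-! ### A criterion for isomorphisms in homology -/

section HomologyCriterion

variable {K : Type w} [CommRing K] {C D : ChainComplex (ModuleCat.{u} K) ℕ}

theorem exists_iCycles_eq (n : ℕ) (x : C.X n) (hx : ∀ m, (C.d n m).hom x = 0) :
    ∃ z : C.cycles n, (C.iCycles n).hom z = x := by
  have h : (ShortComplex.mk (C.iCycles n) (C.d n _) (C.iCycles_d n _)).Exact :=
    ShortComplex.exact_of_f_is_kernel _ (C.cyclesIsKernel n ((ComplexShape.down ℕ).next n) rfl)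
  exact (ShortComplex.moduleCat_exact_iff _).1 h x (hx _)

theorem exists_toCycles_eq (n : ℕ) (z : C.cycles n) (hz : (C.homologyπ n).hom z = 0) :
    ∃ w : C.X (n + 1), (C.d (n + 1) n).hom w = (C.iCycles n).hom z := by
  have hn : (ComplexShape.down ℕ).prev n = n + 1 := by simp
  have h : (ShortComplex.mk (C.toCycles (n + 1) n) (C.homologyπ n)
      (C.toCycles_comp_homologyπ (n + 1) n)).Exact :=
    ShortComplex.exact_of_g_is_cokernel _ (C.homologyIsCokernel (n + 1) n hn)
  obtain ⟨w, hw⟩ := (ShortComplex.moduleCat_exact_iff _).1 h z hz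
  refine ⟨w, ?_⟩
  have := congrArg (fun f => f.hom w) (C.toCycles_i (n + 1) n)
  change (C.iCycles n).hom ((C.toCycles (n + 1) n).hom w) = _ at this
  rw [← this]
  exact congrArg _ hw

theorem homologyπ_eq_zero (n : ℕ) (z : C.cycles n) (w : C.X (n + 1))
    (h : (C.d (n + 1) n).hom w = (C.iCycles n).hom z) : (C.homologyπ n).hom z = 0 := by
  have hz : z = (C.toCycles (n + 1) n).hom w := by
    apply (ModuleCat.mono_iff_injective (C.iCycles n)).1 inferInstance
    have := congrArg (fun f => f.hom w) (C.toCycles_i (n + 1) n)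
    exact h.symm.trans this.symm
  rw [hz]
  exact congrArg (fun f => f.hom w) (C.toCycles_comp_homologyπ (n + 1) n)

/-- An injective morphism of chain complexes, each relative cycle of which is the sum of a
boundary and an element of the image, induces isomorphisms in homology. -/
theorem isIso_homologyMap_of_injective (φ : C ⟶ D)
    (hinj : ∀ n, Function.Injective (φ.f n).hom)
    (hrel : ∀ n (y : D.X n), (∀ m, (D.d n m).hom y ∈ LinearMap.range (φ.f m).hom) →
      ∃ (w : D.X (n + 1)) (c : C.X n), y = (D.d (n + 1) n).hom w + (φ.f n).hom c) (n : ℕ) :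
    IsIso (HomologicalComplex.homologyMap φ n) := by
  have hcomm : ∀ i j (c : C.X i), (D.d i j).hom ((φ.f i).hom c) = (φ.f j).hom ((C.d i j).hom c) :=
    fun i j c => congrArg (fun f => f.hom c) (φ.comm i j)
  have hπC : Function.Surjective (C.homologyπ n).hom :=
    (ModuleCat.epi_iff_surjective (C.homologyπ n)).1 inferInstance
  have hπD : Function.Surjective (D.homologyπ n).hom :=
    (ModuleCat.epi_iff_surjective (D.homologyπ n)).1 inferInstance
  have hnat : ∀ z : C.cycles n, (HomologicalComplex.homologyMap φ n).hom ((C.homologyπ n).hom z) =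
      (D.homologyπ n).hom ((HomologicalComplex.cyclesMap φ n).hom z) := fun z =>
    congrArg (fun f => f.hom z) (HomologicalComplex.homologyπ_naturality φ n)
  have hi : ∀ z : C.cycles n, (D.iCycles n).hom ((HomologicalComplex.cyclesMap φ n).hom z) =
      (φ.f n).hom ((C.iCycles n).hom z) := fun z =>
    congrArg (fun f => f.hom z) (HomologicalComplex.cyclesMap_i φ n)
  have hdd : ∀ (E : ChainComplex (ModuleCat.{u} K) ℕ) i j k (x : E.X i),
      (E.d j k).hom ((E.d i j).hom x) = 0 := fun E i j k x =>
    congrArg (fun f => f.hom x) (E.d_comp_d i j k)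
  have hdi : ∀ (E : ChainComplex (ModuleCat.{u} K) ℕ) m (z : E.cycles n),
      (E.d n m).hom ((E.iCycles n).hom z) = 0 := fun E m z =>
    congrArg (fun f => f.hom z) (E.iCycles_d n m)
  rw [ConcreteCategory.isIso_iff_bijective]
  constructor
  · refine (injective_iff_map_eq_zero (HomologicalComplex.homologyMap φ n).hom).2 fun a ha => ?_
    obtain ⟨z, rfl⟩ := hπC a
    rw [hnat] at ha
    obtain ⟨w, hw⟩ := exists_toCycles_eq n _ ha
    rw [hi] at hw
    -- A chain bounding the image of `z` is a relative cycle. Up to a boundary it comes from `C`,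
    -- and by injectivity its preimage bounds `z`.
    obtain ⟨w', c', rfl⟩ := hrel (n + 1) w fun m => by
      by_cases hm : m + 1 = n + 1
      · obtain rfl : m = n := by omega
        exact ⟨_, hw.symm⟩
      · rw [D.shape _ _ hm]
        exact zero_mem _
    refine homologyπ_eq_zero n z c' (hinj n ?_)
    rw [← hw, map_add, hdd, zero_add, hcomm]
  · intro b
    obtain ⟨z, rfl⟩ := hπD b
    -- A cycle is in particular a relative cycle; its part in `C` is again a cycle by injectivity.
    obtain ⟨w, c, hwc⟩ := hrel n ((D.iCycles n).hom z) fun m => by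
      rw [hdi]
      exact zero_mem _
    have hc : ∀ m, (C.d n m).hom c = 0 := fun m => by
      refine hinj m ?_
      have := hdi D m z
      rw [hwc, map_add, hdd, zero_add, hcomm] at this
      rw [this, map_zero]
    obtain ⟨z', hz'⟩ := exists_iCycles_eq n c hc
    refine ⟨(C.homologyπ n).hom z', ?_⟩
    change (HomologicalComplex.homologyMap φ n).hom ((C.homologyπ n).hom z') = _
    rw [hnat, ← sub_eq_zero, ← map_sub]
    refine homologyπ_eq_zero n _ (-w) ?_
    rw [map_sub, hi, hz', hwc, map_neg]
    abel

end HomologyCriterion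

/-! ### The comparison of oriented and square-commutative chains -/

section Comparison

variable {ι : Type u} {S : PreAbstractSimplicialComplex ι} {K : Type w} [CommRing K] {n : ℕ}

variable (S K n) in
/-- The normalized chains of the nerve of `Z(G(S))`. -/
abbrev NormalizedFace : Type max u w :=
  (faceModule S K) _⦋n⦌ ⧸ degenerateSubmodule (faceModule S K) n

variable (S K) in
/-- The complex `Ω^sc` of the digraph of a simplicial complex. -/
abbrev faceOmega : ChainComplex (ModuleCat.{max u w} K) ℕ :=
  OmegaSC K (faceDigraph S).Vertex

variable (S K n) in
/-- The component of `Ω^sc` as a submodule of the normalized chains. -/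
def omegaFace : Submodule K (NormalizedFace S K n) :=
  omegaSubmodule (normalizedChains (faceModule S K))
    (fun n => (arrowChains S K n).map (degenerateSubmodule (faceModule S K) n).mkQ) n

variable (S K n) in
/-- The normalized chain described by a linear combination of words. -/
def wordClass : (Word ι n →₀ K) →ₗ[K] NormalizedFace S K n :=
  (degenerateSubmodule (faceModule S K) n).mkQ ∘ₗ pathChain S K n

variable (S K n) in
/-- The boundary map of the normalized chains. -/
def normalizedBoundary : NormalizedFace S K (n + 1) →ₗ[K] NormalizedFace S K n :=
  ((normalizedChains (faceModule S K)).d (n + 1) n).hom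

/-! ### The components of Ω^sc as modules of cube chains -/

theorem normalizedBoundary_mkQ (x : (faceModule S K) _⦋n + 1⦌) :
    normalizedBoundary S K n ((degenerateSubmodule (faceModule S K) (n + 1)).mkQ x) =
      (degenerateSubmodule (faceModule S K) n).mkQ (faceBoundary S K n x) := rfl

theorem normalizedBoundary_wordClass {c : Word ι (n + 1) →₀ K} (hc : c ∈ cubeChains S K (n + 1)) :
    normalizedBoundary S K n (wordClass S K (n + 1) c) = wordClass S K n (wordBoundary n c) := by
  rw [wordClass, LinearMap.comp_apply, normalizedBoundary_mkQ, d_pathChain hc]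
  rfl

theorem mem_omegaFace_zero {x : NormalizedFace S K 0} : x ∈ omegaFace S K 0 ↔
    x ∈ (arrowChains S K 0).map (degenerateSubmodule (faceModule S K) 0).mkQ := by
  refine mem_omegaSubmodule.trans ⟨fun h => h.1, fun h => ⟨h, fun m => ?_⟩⟩
  rw [(normalizedChains (faceModule S K)).shape 0 m (by simp)]
  exact zero_mem _

theorem mem_omegaFace_succ {x : NormalizedFace S K (n + 1)} : x ∈ omegaFace S K (n + 1) ↔
    x ∈ (arrowChains S K (n + 1)).map (degenerateSubmodule (faceModule S K) (n + 1)).mkQ ∧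
    normalizedBoundary S K n x ∈
      (arrowChains S K n).map (degenerateSubmodule (faceModule S K) n).mkQ := by
  refine mem_omegaSubmodule.trans ⟨fun h => ⟨h.1, h.2 n⟩, fun h => ⟨h.1, fun m => ?_⟩⟩
  by_cases hm : m = n
  · subst hm
    exact h.2
  · rw [(normalizedChains (faceModule S K)).shape (n + 1) m (by simpa using hm)]
    exact zero_mem _

theorem wordClass_mem_map {c : Word ι n →₀ K} (hc : c ∈ wordChains S K n) : wordClass S K n c ∈
    (arrowChains S K n).map (degenerateSubmodule (faceModule S K) n).mkQ :=
  ⟨_, pathChain_mem_arrowChains hc, rfl⟩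

theorem wordClass_mem_omegaFace {c : Word ι n →₀ K} (hc : c ∈ cubeChains S K n) :
    wordClass S K n c ∈ omegaFace S K n := by
  cases n with
  | zero => exact mem_omegaFace_zero.2 (wordClass_mem_map (wordChains_of_cubeChains hc))
  | succ n =>
    refine mem_omegaFace_succ.2 ⟨wordClass_mem_map (wordChains_of_cubeChains hc), ?_⟩
    rw [normalizedBoundary_wordClass hc]
    exact wordClass_mem_map (wordChains_of_cubeChains (wordBoundary_mem_cubeChains hc))

theorem eq_zero_of_wordClass_eq_zero {c : Word ι n →₀ K} (hc : c ∈ cubeChains S K n)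
    (h : wordClass S K n c = 0) : c = 0 :=
  eq_zero_of_pathChain_mem_degenerate (wordChains_of_cubeChains hc)
    ((Submodule.Quotient.mk_eq_zero _).1 h)

theorem exists_wordClass_of_mem_map {x : NormalizedFace S K n}
    (hx : x ∈ (arrowChains S K n).map (degenerateSubmodule (faceModule S K) n).mkQ) :
    ∃ c ∈ wordChains S K n, wordClass S K n c = x := by
  obtain ⟨y, hy, rfl⟩ := hx
  obtain ⟨_, ⟨c, hc, rfl⟩, b, hb, rfl⟩ := Submodule.mem_sup.1 (arrowChains_le hy)
  refine ⟨c, hc, ?_⟩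
  rw [map_add, (Submodule.Quotient.mk_eq_zero _).2 hb |> fun h =>
    show (degenerateSubmodule (faceModule S K) n).mkQ b = 0 from h, add_zero]
  rfl

/-- In positive degree the condition on the boundary forces alternation, by
`mem_cubeChains_of_d_mem`. In degree 0 words have no letters, so the sign rule is void. -/
theorem exists_wordClass_of_mem_omegaFace {x : NormalizedFace S K n} (hx : x ∈ omegaFace S K n) :
    ∃ c ∈ cubeChains S K n, wordClass S K n c = x := by
  cases n with
  | zero =>
    obtain ⟨c, hc, rfl⟩ := exists_wordClass_of_mem_map (mem_omegaFace_zero.1 hx)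
    have hcw := mem_wordChains.1 hc
    refine ⟨c, mem_cubeChains.2 ⟨⟨fun w hw => (hcw w hw).1, fun w π => ?_⟩,
      fun w hw => (hcw w hw).2⟩, rfl⟩
    rw [Subsingleton.elim π 1]
    simp
  | succ n =>
    rw [mem_omegaFace_succ] at hx
    obtain ⟨c, hc, rfl⟩ := exists_wordClass_of_mem_map hx.1
    refine ⟨c, mem_cubeChains_of_d_mem hc ?_, rfl⟩
    obtain ⟨y, hy, hyx⟩ := hx.2
    rw [wordClass, LinearMap.comp_apply, normalizedBoundary_mkQ] at hyx
    have h := (Submodule.Quotient.eq _).1 hyx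
    refine Submodule.mem_sup.2 ⟨y, hy, _, neg_mem h, ?_⟩
    abel

/-! The oriented chains. -/

variable (S K n) in
/-- Antisymmetrization of ordered chains. -/
def orderedToFull : (freeSimplicialModule K (orderedSimplices S)) _⦋n⦌ →ₗ[K]
    (Word ι (n + 1) →₀ K) :=
  (Finsupp.linearCombination K fun f : orderedSimplices S _⦋n⦌ => antisymm K (vertices f) :
    (orderedSimplices S _⦋n⦌ →₀ K) →ₗ[K] (Word ι (n + 1) →₀ K))

theorem orderedToFull_basisElement (f : orderedSimplices S _⦋n⦌) :
    orderedToFull S K n (basisElement K f) = antisymm K (vertices f) := by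
  refine (Finsupp.linearCombination_single K _ _).trans ?_
  rw [one_smul]

theorem fullWord_vertices_mem (f : orderedSimplices S _⦋n⦌) :
    (fullWord (vertices f)).1 ∈ S.faces := by
  obtain ⟨σ, hσ, h⟩ := f.2
  exact fullWord_face hσ h

theorem orientationRelations_le_ker :
    orientationRelations S K n ≤ LinearMap.ker (orderedToFull S K n) := by
  refine sup_le (Submodule.span_le.2 ?_) (Submodule.span_le.2 ?_)
  · rintro _ ⟨⟨f, hf⟩, rfl⟩
    rw [SetLike.mem_coe, LinearMap.mem_ker, orderedToFull_basisElement, antisymm_eq_zero hf]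
  · rintro _ ⟨⟨f, π⟩, rfl⟩
    rw [SetLike.mem_coe, LinearMap.mem_ker, map_sub, map_zsmul, orderedToFull_basisElement,
      orderedToFull_basisElement, show vertices (permute f π) = vertices f ∘ π from rfl,
      antisymm_comp, sub_self]

variable (S K n) in
/-- The oriented chains of a simplicial complex. -/
abbrev Oriented : Type max u w :=
  (freeSimplicialModule K (orderedSimplices S)) _⦋n⦌ ⧸ orientationRelations S K n

variable (S K n) in
/-- Antisymmetrization of oriented chains. -/
def orientedToFull : Oriented S K n →ₗ[K] (Word ι (n + 1) →₀ K) :=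
  (orientationRelations S K n).liftQ (orderedToFull S K n) orientationRelations_le_ker

/-- The oriented simplex with given vertices. -/
def orientedSimplex (K : Type w) [CommRing K] (f : orderedSimplices S _⦋n⦌) : Oriented S K n :=
  (orientationRelations S K n).mkQ (basisElement K f)

theorem orientedToFull_orientedSimplex (f : orderedSimplices S _⦋n⦌) :
    orientedToFull S K n (orientedSimplex K f) = antisymm K (vertices f) := by
  rw [orientedToFull, orientedSimplex, Submodule.mkQ_apply, Submodule.liftQ_apply,
    orderedToFull_basisElement]

theorem orientedSimplex_eq_zero {f : orderedSimplices S _⦋n⦌}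
    (hf : ¬ Function.Injective (vertices f)) : orientedSimplex K f = 0 :=
  (Submodule.Quotient.mk_eq_zero _).2 (basisElement_mem_orientationRelations K f hf)

theorem orientedSimplex_permute (f : orderedSimplices S _⦋n⦌) (π : Equiv.Perm (Fin (n + 1))) :
    orientedSimplex K (permute f π) = ((Equiv.Perm.sign π : ℤˣ) : ℤ) • orientedSimplex K f := by
  rw [← sub_eq_zero, orientedSimplex, orientedSimplex, ← map_zsmul, ← map_sub]
  exact (Submodule.Quotient.mk_eq_zero _).2 (permute_sub_mem_orientationRelations K f π)

theorem oriented_hom_ext {M : Type*} [AddCommGroup M] [Module K M] {f g : Oriented S K n →ₗ[K] M}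
    (h : ∀ s, Function.Injective (vertices s) → f (orientedSimplex K s) = g (orientedSimplex K s)) :
    f = g := by
  refine Submodule.linearMap_qext _ (hom_ext_basisElement fun s => ?_)
  change f (orientedSimplex K s) = g (orientedSimplex K s)
  by_cases hs : Function.Injective (vertices s)
  · exact h s hs
  · rw [orientedSimplex_eq_zero hs, map_zero, map_zero]

/-- A left inverse reads off the coefficient at one chosen ordering of each simplex. This works over
every ring, whereas forgetting all orderings at once would multiply by (n + 1)!. -/
theorem orientedToFull_injective : Function.Injective (orientedToFull S K n) := by
  classical
  by_cases hne : Nonempty ι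
  swap
  · have : (0 : Oriented S K n →ₗ[K] Oriented S K n) = LinearMap.id :=
      oriented_hom_ext fun s _ => absurd ⟨vertices s 0⟩ hne
    refine (injective_iff_map_eq_zero _).2 fun a _ => ?_
    exact (congrArg (fun f => f a) this).symm
  obtain ⟨e, he⟩ := exists_enumeration ι (n + 1)
  let L : (Word ι (n + 1) →₀ K) →ₗ[K] Oriented S K n := Finsupp.linearCombination K fun w =>
    if h : w.2 = e w.1 ∧ IsWord S w then
      orientedSimplex K (⟨w.2, w.1, h.2.face, h.2.mem⟩ : orderedSimplices S _⦋n⦌) else 0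
  have hL : L ∘ₗ orientedToFull S K n = LinearMap.id := by
    refine oriented_hom_ext fun s hs => ?_
    rw [LinearMap.comp_apply, orientedToFull_orientedSimplex, LinearMap.id_apply]
    set w := fullWord (vertices s) with hw
    have hwS : IsWord S w := isWord_fullWord hs (fullWord_vertices_mem s)
    have hwc : w.1.card = n + 1 := card_fullWord hs
    obtain ⟨h₁, h₂⟩ := he w.1 hwc
    obtain ⟨ρ, hρ⟩ : ∃ ρ : Equiv.Perm (Fin (n + 1)), vertices s ∘ ρ = e w.1 := by
      have hex : ∀ i, ∃ j, vertices s j = e w.1 i := fun i => by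
        have h₃ : e w.1 i ∈ (fullWord (e w.1)).1 := by simp [fullWord]
        rw [h₁] at h₃
        simpa [hw, fullWord] using h₃
      choose g hg using hex
      have hgi : Function.Injective g := fun i j hij => h₂ (by rw [← hg, ← hg, hij])
      exact ⟨Equiv.ofBijective g (Finite.injective_iff_bijective.1 hgi), funext hg⟩
    -- Of all orderings of `s`, only the chosen one contributes; its sign occurs twice and cancels.
    rw [antisymm, map_sum, Finset.sum_eq_single ρ]
    · have hcond : (permWord ρ w).2 = e (permWord ρ w).1 ∧ IsWord S (permWord ρ w) :=
        ⟨hρ, hwS.perm ρ⟩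
      rw [map_zsmul, Finsupp.linearCombination_single, one_smul, dif_pos hcond]
      have : (⟨(permWord ρ w).2, (permWord ρ w).1, hcond.2.face, hcond.2.mem⟩ :
          orderedSimplices S _⦋n⦌) = permute s ρ := ext_vertices rfl
      rw [this, orientedSimplex_permute, smul_smul, ← Units.val_mul, Int.units_mul_self,
        Units.val_one, one_smul]
    · intro π _ hπ
      rw [map_zsmul, Finsupp.linearCombination_single, dif_neg, smul_zero, smul_zero]
      rintro ⟨h, -⟩
      refine hπ (Equiv.ext fun i => hs ?_)
      have h₃ : vertices s ∘ π = vertices s ∘ ρ := h.trans hρ.symm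
      exact congrFun h₃ i
    · exact fun h => absurd (Finset.mem_univ _) h
  exact Function.LeftInverse.injective (g := L) fun a => congrArg (fun f => f a) hL

theorem orientedToFull_mem (x : Oriented S K n) :
    orientedToFull S K n x ∈ fullChains S K (n + 1) := by
  have h : LinearMap.range (orientedToFull S K n) ≤ fullChains S K (n + 1) := by
    rintro _ ⟨x, rfl⟩
    obtain ⟨y, rfl⟩ := Submodule.mkQ_surjective _ x
    have hy : y ∈ Submodule.span K (Set.range (basisElement K : orderedSimplices S _⦋n⦌ → _)) := by
      rw [span_basisElement]
      trivial
    induction hy using Submodule.span_induction with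
    | mem y hy =>
      obtain ⟨s, rfl⟩ := hy
      change orientedToFull S K n (orientedSimplex K s) ∈ _
      rw [orientedToFull_orientedSimplex]
      by_cases hs : Function.Injective (vertices s)
      · exact antisymm_mem_fullChains hs (fullWord_vertices_mem s)
      · rw [antisymm_eq_zero hs]
        exact zero_mem _
    | zero => rw [map_zero, map_zero]; exact zero_mem _
    | add a b _ _ ha hb => rw [map_add, map_add]; exact add_mem ha hb
    | smul r a _ ha => rw [map_smul, map_smul]; exact Submodule.smul_mem _ r ha
  exact h ⟨x, rfl⟩

theorem fullChains_le_range :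
    fullChains S K (n + 1) ≤ LinearMap.range (orientedToFull S K n) := by
  refine fullChains_le_span.trans (Submodule.span_le.2 ?_)
  rintro _ ⟨f, hf, hS, rfl⟩
  refine ⟨orientedSimplex K (⟨f, (fullWord f).1, hS, (isWord_fullWord hf hS).mem⟩ :
    orderedSimplices S _⦋n⦌), ?_⟩
  exact orientedToFull_orientedSimplex _

/-! ### The subdivision map -/

theorem mapDomain_lastFace_mem_cubeChains {z : Word ι (n + 1) →₀ K}
    (hz : z ∈ fullChains S K (n + 1)) : Finsupp.mapDomain lastFace z ∈ cubeChains S K n := by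
  rw [mem_fullChains] at hz
  refine mem_cubeChains.2 ⟨mapDomain_lastFace_mem hz.1, fun w hw => ?_⟩
  obtain ⟨w', h₁, h₂⟩ := card_of_mapDomain_lastFace_ne_zero hw
  rw [← h₂, hz.2 w' h₁]
  exact Nat.lt_succ_self n

variable (S K n) in
/-- The linear combination of words that describes an oriented chain. -/
def orientedToWord : Oriented S K n →ₗ[K] (Word ι n →₀ K) :=
  Finsupp.lmapDomain K K lastFace ∘ₗ orientedToFull S K n

theorem orientedToWord_mem (x : Oriented S K n) : orientedToWord S K n x ∈ cubeChains S K n :=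
  mapDomain_lastFace_mem_cubeChains (orientedToFull_mem x)

variable (S K n) in
/-- The boundary map of the oriented chains. -/
def orientedBoundary : Oriented S K (n + 1) →ₗ[K] Oriented S K n :=
  ((orientedChains S K).d (n + 1) n).hom

theorem orientedBoundary_orientedSimplex (s : orderedSimplices S _⦋n + 1⦌) :
    orientedBoundary S K n (orientedSimplex K s) = ∑ i : Fin (n + 2), (-1 : ℤ) ^ (i : ℕ) •
      orientedSimplex K ((orderedSimplices S).δ i s) := by
  have h : orientedBoundary S K n (orientedSimplex K s) = (orientationRelations S K n).mkQ
      (((chains (freeSimplicialModule K (orderedSimplices S))).d (n + 1) n).hom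
        (basisElement K s)) := rfl
  rw [h, chains_d_apply, map_sum]
  refine Finset.sum_congr rfl fun i _ => ?_
  rw [δ_basisElement, map_zsmul]
  rfl

/-- Deleting two last letters kills an alternating chain, so only the first face is left of the
boundary. It commutes with the last face, and on an antisymmetrized simplex it gives the simplicial
boundary. -/
theorem wordBoundary_orientedToWord (x : Oriented S K (n + 1)) :
    wordBoundary n (orientedToWord S K (n + 1) x) =
      orientedToWord S K n (orientedBoundary S K n x) := by
  have h : wordBoundary n ∘ₗ orientedToWord S K (n + 1) =
      orientedToWord S K n ∘ₗ orientedBoundary S K n := by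
    refine oriented_hom_ext fun s hs => ?_
    have hm := antisymm_mem_fullChains (K := K) hs (fullWord_vertices_mem s)
    rw [LinearMap.comp_apply, LinearMap.comp_apply, orientedBoundary_orientedSimplex, map_sum,
      orientedToWord, LinearMap.comp_apply, orientedToFull_orientedSimplex,
      Finsupp.lmapDomain_apply, wordBoundary_apply,
      mapDomain_lastFace_lastFace (mem_fullChains.1 hm).1, smul_zero, add_zero,
      ← Finsupp.mapDomain_comp]
    have hcomp : (firstFace ∘ lastFace : Word ι (n + 2) → Word ι n) = lastFace ∘ firstFace := rfl
    rw [hcomp, Finsupp.mapDomain_comp, mapDomain_firstFace_antisymm hs]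
    change Finsupp.lmapDomain K K lastFace _ = _
    rw [map_sum]
    refine Finset.sum_congr rfl fun i _ => ?_
    rw [map_zsmul, map_zsmul, orientedToWord, LinearMap.comp_apply,
      orientedToFull_orientedSimplex]
    rfl
  exact congrArg (fun f => f x) h

variable (S K n) in
/-- The comparison of oriented chains and square-commutative chains. -/
def orientedToOmega : Oriented S K n →ₗ[K] omegaFace S K n :=
  LinearMap.codRestrict _ (wordClass S K n ∘ₗ orientedToWord S K n)
    fun x => wordClass_mem_omegaFace (orientedToWord_mem x)

theorem orientedToOmega_injective : Function.Injective (orientedToOmega S K n) := by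
  refine (injective_iff_map_eq_zero _).2 fun x hx => ?_
  have h₁ : wordClass S K n (orientedToWord S K n x) = 0 := congrArg Subtype.val hx
  have h₂ := eq_zero_of_wordClass_eq_zero (orientedToWord_mem x) h₁
  have h₃ := mapDomain_lastFace_injective (orientedToFull_mem x) h₂
  exact (injective_iff_map_eq_zero _).1 orientedToFull_injective x h₃

variable (S K) in
/-- The chain map from the oriented chains of a simplicial complex to the square-commutative
chains of its digraph: it sends an oriented simplex to the alternating sum of the paths from the
simplex to its vertices. -/
def orientedToOmegaHom : orientedChains S K ⟶ faceOmega S K where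
  f n := ModuleCat.ofHom (orientedToOmega S K n)
  comm' i j hij := by
    obtain rfl : j + 1 = i := hij
    refine ModuleCat.hom_ext (LinearMap.ext fun x => Subtype.ext ?_)
    change normalizedBoundary S K j (wordClass S K (j + 1) (orientedToWord S K (j + 1) x)) =
      wordClass S K j (orientedToWord S K j (orientedBoundary S K j x))
    rw [normalizedBoundary_wordClass (orientedToWord_mem x)]
    exact congrArg (wordClass S K j) (wordBoundary_orientedToWord x)

/-- Coefficients on words are determined by normalized chains. So a boundary in the image of the
oriented chains is supported, as a chain of words, on sets with one element more than there are
letters. -/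
theorem hasFullBoundary_of_mem_range {c : Word ι n →₀ K} (hc : c ∈ cubeChains S K n)
    (h : ∀ m, ((faceOmega S K).d n m).hom ⟨wordClass S K n c, wordClass_mem_omegaFace hc⟩ ∈
      LinearMap.range ((orientedToOmegaHom S K).f m).hom) : HasFullBoundary c := by
  cases n with
  | zero => trivial
  | succ n =>
    obtain ⟨x, hx⟩ := h n
    have h₁ : wordClass S K n (orientedToWord S K n x) =
        normalizedBoundary S K n (wordClass S K (n + 1) c) := congrArg Subtype.val hx
    rw [normalizedBoundary_wordClass hc, ← sub_eq_zero, ← map_sub] at h₁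
    have h₂ := eq_zero_of_wordClass_eq_zero
      (sub_mem (orientedToWord_mem x) (wordBoundary_mem_cubeChains hc)) h₁
    rw [sub_eq_zero] at h₂
    change ∀ w, wordBoundary n c w ≠ 0 → w.1.card = n + 1
    rw [← h₂]
    intro w hw
    obtain ⟨w', h₃, h₄⟩ := card_of_mapDomain_lastFace_ne_zero hw
    rw [← h₄]
    exact (mem_fullChains.1 (orientedToFull_mem x)).2 w' h₃

theorem isIso_homologyMap_orientedToOmegaHom (n : ℕ) :
    IsIso (HomologicalComplex.homologyMap (orientedToOmegaHom S K) n) := by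
  refine isIso_homologyMap_of_injective _ (fun n => orientedToOmega_injective) (fun n y hy => ?_) n
  obtain ⟨y, hyo⟩ := y
  obtain ⟨c, hc, rfl⟩ := exists_wordClass_of_mem_omegaFace hyo
  obtain ⟨b, hb, z, hz, hbz⟩ := exists_eq_wordBoundary_add hc (hasFullBoundary_of_mem_range hc hy)
  obtain ⟨x, hx⟩ := fullChains_le_range hz
  refine ⟨⟨wordClass S K (n + 1) b, wordClass_mem_omegaFace hb⟩, x, Subtype.ext ?_⟩
  change wordClass S K n c = normalizedBoundary S K n (wordClass S K (n + 1) b) +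
    wordClass S K n (orientedToWord S K n x)
  rw [normalizedBoundary_wordClass hb, ← map_add, hbz, orientedToWord, LinearMap.comp_apply, hx]
  rfl

end Comparison

end

end PathHomology

theorem mainTheorem4 {K : Type*} [CommRing K] {ι : Type*} (S : PreAbstractSimplicialComplex ι)
    (n : ℕ) :
    Nonempty (PathHomology.simplicialHomology S K n ≅
      PathHomology.homologySC K (PathHomology.faceDigraph S).Vertex n) := by
  have := PathHomology.isIso_homologyMap_orientedToOmegaHom (S := S) (K := K) n
  have e := CategoryTheory.asIso
    (HomologicalComplex.homologyMap (PathHomology.orientedToOmegaHom S K) n)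
  exact ⟨e⟩
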